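/- **Setting.** Let $T>0$, $n_e\in\mathbb N$, $\Omega=(0,1)$, let $\|\cdot\|$ be the norm of $L_2(\Omega)$, and let $\alpha,\beta\in C^2([0,T])$ with $\alpha'<0<\beta'$ on $[0,T]$ and $0<\gamma_0<\gamma(t)<\gamma_1<\infty$ for $t\in[0,T]$, where $\gamma=\beta-\alpha$. Put $\Omega_t=(\alpha(t),\beta(t))$. For $i=1,\dots,n_e$ let $a_i:\mathbb R^{n_e}\to\mathbb R$ be Lipschitz continuous with $0<m_a\le a_i\le M_a$, let $u_{i0}\in H^1_0(\Omega_0)$, and let $f_i\in L_2(0,T;L_2(\Omega_t))$ with $f_i(\cdot,t)\in L_2(\Omega_t)$ for every $t\in(0,T)$. Put $$g_i(y,t)=f_i(\alpha(t)+\gamma(t)y,t),\quad v_{i0}(y)=u_{i0}(\alpha(0)+\gamma(0)y),\quad b_1(y,t)=\frac{\alpha'(t)+\gamma'(t)y}{\gamma(t)},\quad b_2(t)=\frac1{\gamma(t)^2},\quad l_t(w)=\gamma(t)\int_0^1 w\,dy .$$ **Continuous problem.** Let $\mathbf v=(v_1,\dots,v_{n_e})$ be a weak solution of the transformed problem: $v_i(\cdot,t)\in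 H^1_0(\Omega)\cap H^2(\Omega)$, bounded in $H^2(\Omega)$ uniformly in $t\in[0,T]$; $\partial_tv_i\in L_2(0,T;L_2(\Omega))$; $v_i(\cdot,0)=v_{i0}$; and for all $t\in(0,T)$, all $w\in H^1_0(\Omega)$ and all $i$, $$\int_0^1\partial_tv_i\,w\,dy+a_i\big(l_t(v_1),\dots,l_t(v_{n_e})\big)b_2(t)\int_0^1\partial_yv_i\,\partial_yw\,dy-\int_0^1b_1(y,t)\,\partial_yv_i\,w\,dy=\int_0^1g_i(y,t)\,w\,dy .$$ Assume that $v_i\in W^{3,\infty}(0,T;L_2(\Omega))\cap W^{2,\infty}(0,T;H^1(\Omega))$; precisely, as a function of $t\in[0,T]$, $v_i$ is $C^2$ with Lipschitz second derivative into $L_2(\Omega)$, and $\partial_y v_i$ is $C^1$ with Lipschitz derivative into $L_2(\Omega)$. **Scheme.** Let $k\ge1$, let $0=x_0<\dots<x_{n_t}=1$ be a partition of $\Omega$ with largest interval length $h$, and let $S_h^k$ be the space of continuous functions on $[0,1]$ that vanish at $0$ and $1$ and are polynomials of degree at most $k$ on each $[x_{e-1},x_e]$. In each $[x_{e-1},x_e]$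 choose $k+1$ distinct nodes including the end points, and let $I_hu\in S_h^k$ be the interpolant of $u$ at the nodes. Let $N\ge1$, $\delta=T/N$, $t_n=n\delta$, $t_{n-1/2}=(n-\tfrac12)\delta$. For $\mathbf Z,\mathbf V,\mathbf V'$ with components in $S_h^k$, say that $\mathbf V'$ is the *step* from $\mathbf V$ at midpoint $t$ with coefficient argument $\mathbf Z$ if for all $i$ and all $W\in S_h^k$ $$\int_0^1\frac{V_i'-V_i}{\delta}W\,dy+a_i\big(l_t(Z_1),\dots,l_t(Z_{n_e})\big)b_2(t)\int_0^1\partial_y\frac{V_i'+V_i}2\,\partial_yW\,dy-\int_0^1b_1(y,t)\,\partial_y\frac{V'_i+V_i}2\,W\,dy=\int_0^1g_i(y,t)\,W\,dy .$$ Let $V_i^{(0)}=I_hv_{i0}$; let the predictor $\mathbf V^{(1,0)}$ be the step from $\mathbf V^{(0)}$ at midpoint $t_{1/2}$ with argument $\mathbf V^{(0)}$; let $\mathbf V^{(1)}$ be the step from $\mathbf V^{(0)}$ at midpoint $t_{1/2}$ with argument $\tfrac12(\mathbf V^{(1,0)}+\mathbf V^{(0)})$; and for $2\le n\le N$ let $\mathbf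 V^{(n)}$ be the step from $\mathbf V^{(n-1)}$ at midpoint $t_{n-1/2}$ with argument $\tfrac32\mathbf V^{(n-1)}-\tfrac12\mathbf V^{(n-2)}$. **Theorem.** For every $M$ there is a constant $C>0$, depending only on the data, on $\mathbf v$ and on $M$, such that the following holds. For every $k\ge1$ for which $\|v_i(\cdot,t)\|_{H^{k+1}(\Omega)}\le M$ and $\|v_i(\cdot,t)-v_i(\cdot,s)\|_{H^{k+1}(\Omega)}\le M|t-s|$ for all $s,t\in[0,T]$ and all $i$ (in particular $v_i(\cdot,t)\in H^{k+1}(\Omega)$), every partition, every choice of nodes and every $N\ge1$, each solution of the scheme satisfies $$\|V_i^{(n)}-v_i(\cdot,t_n)\|\le C\,(h^{k+1}+\delta^2),\qquad n=1,\dots,N,\quad i=1,\dots,n_e .$$ Thus $C$ does not depend on $h$, $\delta$, $n$, $i$, the partition or the nodes, and it depends on $k$ only through the bound $M$ on the $W^{1,\infty}(0,T;H^{k+1}(\Omega))$ norm of $\mathbf v$. -/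

import Mathlib

open MeasureTheory Set Filter Topology
open scoped ContDiff Polynomial

noncomputable section

namespace CNGalerkin

/-! ### Sobolev spaces on an interval -/

/-- `g` is the weak (distributional) derivative of `u` on the open interval `(a, b)`. -/
def HasWeakDeriv (a b : ℝ) (u g : ℝ → ℝ) : Prop :=
  ∀ φ : ℝ → ℝ, ContDiff ℝ ∞ φ → HasCompactSupport φ → tsupport φ ⊆ Ioo a b →
    ∫ y in Ioo a b, u y * deriv φ y = -∫ y in Ioo a b, g y * φ y

/-- `u`, taken as its continuous representative, belongs to `H₀¹(a, b)`. -/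
structure MemH01 (a b : ℝ) (u : ℝ → ℝ) : Prop where
  cont : ContinuousOn u (Icc a b)
  left : u a = 0
  right : u b = 0
  weak : ∃ g : ℝ → ℝ, MemLp g 2 (volume.restrict (Ioo a b)) ∧ HasWeakDeriv a b u g

/-- The Hilbert space `L₂(Ω)`, `Ω = (0, 1)`. -/
abbrev L2 : Type := Lp ℝ 2 (volume.restrict (Ioo (0 : ℝ) 1))

/-- The space `H₀¹(Ω)`, as a subset of `L₂(Ω)`. -/
def H01 : Set L2 := {u | ∃ w : ℝ → ℝ, MemH01 0 1 w ∧ u =ᵐ[volume.restrict (Ioo (0 : ℝ) 1)] w}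

open Classical in
/-- The weak derivative `∂u/∂y` of `u ∈ H¹(Ω)`, an element of `L₂(Ω)`
(and `0` if `u` is not in `H¹(Ω)`). -/
def dy (u : L2) : L2 := if h : ∃ g : L2, HasWeakDeriv 0 1 u g then h.choose else 0

/-- Membership in `H^m(Ω)`: there are weak derivatives in `L₂(Ω)` up to order `m`. -/
def MemH : ℕ → L2 → Prop
  | 0, _ => True
  | m + 1, u => ∃ g : L2, HasWeakDeriv 0 1 u g ∧ MemH m g

/-- The norm of `H^m(Ω)`. -/
def sobolevNorm (m : ℕ) (u : L2) : ℝ := √(∑ j ∈ Finset.range (m + 1), ‖dy^[j] u‖ ^ 2)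

/-- Weak derivatives are unique, so `dy` is the weak derivative. -/
theorem dy_eq {u g : L2} (h : HasWeakDeriv 0 1 u g) : dy u = g := by
  have hex : ∃ g : L2, HasWeakDeriv 0 1 u g := ⟨g, h⟩
  have h' : HasWeakDeriv 0 1 u (dy u) := by
    have : dy u = hex.choose := by simp only [dy, dif_pos hex]
    rw [this]
    exact hex.choose_spec
  generalize dy u = g' at h'
  have loc : ∀ q : L2, LocallyIntegrableOn (q : ℝ → ℝ) (Ioo (0 : ℝ) 1) := fun q =>
    IntegrableOn.locallyIntegrableOn ((Lp.memLp q).integrable (by norm_num))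
  have key : ∀ᵐ y ∂(volume : Measure ℝ), y ∈ Ioo (0 : ℝ) 1 → (g' : ℝ → ℝ) y - (g : ℝ → ℝ) y = 0 := by
    refine isOpen_Ioo.ae_eq_zero_of_integral_contDiff_smul_eq_zero
      (f := fun y => (g' : ℝ → ℝ) y - (g : ℝ → ℝ) y) ((loc g').sub (loc g)) ?_
    intro φ hφ hc hs
    have hint : ∀ q : L2, IntegrableOn (fun y => (q : ℝ → ℝ) y * φ y) (Ioo (0 : ℝ) 1) := by
      intro q
      obtain ⟨B, hB⟩ := hc.exists_bound_of_continuous hφ.continuous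
      exact Integrable.mul_bdd ((Lp.memLp q).integrable (by norm_num))
        hφ.continuous.aestronglyMeasurable (Eventually.of_forall hB)
    have e1 := h φ hφ hc hs
    have e2 := h' φ hφ hc hs
    have e3 : ∫ y in Ioo (0 : ℝ) 1, ((g' : ℝ → ℝ) y * φ y - (g : ℝ → ℝ) y * φ y) = 0 := by
      rw [integral_sub (hint g') (hint g)]
      linarith
    refine Eq.trans ?_ e3
    refine Eq.trans ?_ (integral_indicator measurableSet_Ioo)
    congr 1
    funext y
    by_cases hy : y ∈ Ioo (0 : ℝ) 1
    · simp only [indicator_of_mem hy, smul_eq_mul]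
      ring
    · have : φ y = 0 := by
        by_contra hne
        exact hy (hs (subset_tsupport φ hne))
      simp [indicator_of_notMem hy, this]
  apply Lp.ext
  rw [EventuallyEq, ae_restrict_iff' measurableSet_Ioo]
  filter_upwards [key] with y hy hmem
  exact sub_eq_zero.mp (hy hmem)

/-! ### The continuous problem -/

/-- The data of the moving boundary problem for a system of `ne` equations. -/
structure Data (ne : ℕ) where
  /-- final time -/
  T : ℝ
  /-- left boundary -/
  α : ℝ → ℝ
  /-- right boundary -/
  β : ℝ → ℝ
  /-- diffusion coefficients -/
  a : Fin ne → (Fin ne → ℝ) → ℝ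
  /-- right-hand sides `f_i(x, t)` -/
  f : Fin ne → ℝ → ℝ → ℝ
  /-- initial values `u_{i0}(x)` -/
  u0 : Fin ne → ℝ → ℝ

namespace Data

variable {ne : ℕ} (D : Data ne)

/-- `γ = β - α`. -/
def γ (t : ℝ) : ℝ := D.β t - D.α t

/-- `α'`, one-sided at the end points of `[0, T]`. -/
def α' (t : ℝ) : ℝ := derivWithin D.α (Icc 0 D.T) t

/-- `β'`, one-sided at the end points of `[0, T]`. -/
def β' (t : ℝ) : ℝ := derivWithin D.β (Icc 0 D.T) t

/-- `γ' = β' - α'`. -/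
def γ' (t : ℝ) : ℝ := D.β' t - D.α' t

/-- `b₁(y, t) = (α'(t) + γ'(t) y) / γ(t)`. -/
def b1 (y t : ℝ) : ℝ := (D.α' t + D.γ' t * y) / D.γ t

/-- `b₂(t) = 1 / γ(t)²`. -/
def b2 (t : ℝ) : ℝ := 1 / D.γ t ^ 2

/-- `g_i(y, t) = f_i(α(t) + γ(t) y, t)`. -/
def g (i : Fin ne) (y t : ℝ) : ℝ := D.f i (D.α t + D.γ t * y) t

/-- `v_{i0}(y) = u_{i0}(α(0) + γ(0) y)`. -/
def v0 (i : Fin ne) (y : ℝ) : ℝ := D.u0 i (D.α 0 + D.γ 0 * y)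

/-- The functional `l(w) = γ(t) ∫₀¹ w dy` at time `t`. -/
def l (t : ℝ) (w : L2) : ℝ := D.γ t * ∫ y in Ioo (0 : ℝ) 1, w y

/-- The convection term `∫₀¹ b₁(y, t) (∂u/∂y) w dy`. -/
def conv (t : ℝ) (u w : L2) : ℝ := ∫ y in Ioo (0 : ℝ) 1, D.b1 y t * dy u y * w y

/-- The source term `∫₀¹ g_i(y, t) w dy`. -/
def source (i : Fin ne) (t : ℝ) (w : L2) : ℝ := ∫ y in Ioo (0 : ℝ) 1, D.g i y t * w y

/-- The standing hypotheses on the data. -/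
structure Hypotheses : Prop where
  T_pos : 0 < D.T
  α_smooth : ContDiffOn ℝ 2 D.α (Icc 0 D.T)
  β_smooth : ContDiffOn ℝ 2 D.β (Icc 0 D.T)
  α_deriv : ∀ t ∈ Icc 0 D.T, D.α' t < 0
  β_deriv : ∀ t ∈ Icc 0 D.T, 0 < D.β' t
  γ_bounds : ∃ γ₀ γ₁ : ℝ, 0 < γ₀ ∧ ∀ t ∈ Icc 0 D.T, γ₀ < D.γ t ∧ D.γ t < γ₁
  u0_mem : ∀ i, MemH01 (D.α 0) (D.β 0) (D.u0 i)
  /-- `f_i ∈ L₂(0, T; L₂(Ω_t))`, that is, `f_i` is square integrable over the moving domain. -/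
  f_mem : ∀ i, MemLp (fun p : ℝ × ℝ => D.f i p.1 p.2) 2
    (volume.restrict {p : ℝ × ℝ | p.2 ∈ Ioo 0 D.T ∧ p.1 ∈ Ioo (D.α p.2) (D.β p.2)})
  /-- The scheme evaluates `f_i` at single times, so every time slice is in `L₂(Ω_t)`. -/
  f_slice : ∀ i, ∀ t ∈ Ioo 0 D.T,
    MemLp (fun x => D.f i x t) 2 (volume.restrict (Ioo (D.α t) (D.β t)))
  a_lipschitz : ∀ i, ∃ K, LipschitzWith K (D.a i)
  a_bounds : ∃ m M : ℝ, 0 < m ∧ ∀ i s, m ≤ D.a i s ∧ D.a i s ≤ M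

/-- The time derivative in `L₂(Ω)` on `[0, T]` (one-sided at the end points). -/
def dt (w : ℝ → L2) (t : ℝ) : L2 := derivWithin w (Icc 0 D.T) t

/-- Weak solutions `v = (v_1, …, v_ne)` of the problem on the fixed domain `(0, 1)`; `v_i(·, t)`
is an element of `L₂(Ω)`. -/
structure IsWeakSolution (v : Fin ne → ℝ → L2) : Prop where
  mem_H01 : ∀ i, ∀ t ∈ Icc 0 D.T, v i t ∈ H01
  mem_H2 : ∀ i, ∃ B : ℝ, ∀ t ∈ Icc 0 D.T, MemH 2 (v i t) ∧ sobolevNorm 2 (v i t) ≤ B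
  differentiable : ∀ i, DifferentiableOn ℝ (v i) (Icc 0 D.T)
  dt_mem : ∀ i, MemLp (D.dt (v i)) 2 (volume.restrict (Ioo 0 D.T))
  equation : ∀ i, ∀ t ∈ Ioo 0 D.T, ∀ w ∈ H01,
    inner ℝ (D.dt (v i) t) w
      + D.a i (fun j => D.l t (v j t)) * D.b2 t * inner ℝ (dy (v i t)) (dy w)
      - D.conv t (v i t) w = D.source i t w
  initial : ∀ i, v i 0 =ᵐ[volume.restrict (Ioo (0 : ℝ) 1)] D.v0 i

/-- Regularity in time: `w ∈ W^{3,∞}(0, T; L₂(Ω)) ∩ W^{2,∞}(0, T; H¹(Ω))`. -/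
structure TimeRegular (w : ℝ → L2) : Prop where
  smooth : ContDiffOn ℝ 2 w (Icc 0 D.T)
  lipschitz : ∃ K, LipschitzOnWith K (D.dt (D.dt w)) (Icc 0 D.T)
  smooth_dy : ContDiffOn ℝ 1 (fun t => dy (w t)) (Icc 0 D.T)
  lipschitz_dy : ∃ K, LipschitzOnWith K (D.dt (fun t => dy (w t))) (Icc 0 D.T)

/-- Regularity in space: `w ∈ W^{1,∞}(0, T; H^{k+1}(Ω))`, where `M` bounds both the
`H^{k+1}(Ω)` norm of `w(t)` and the Lipschitz constant of `w : [0, T] → H^{k+1}(Ω)`. -/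
structure SpaceRegular (k : ℕ) (M : ℝ) (w : ℝ → L2) : Prop where
  mem : ∀ t ∈ Icc 0 D.T, MemH (k + 1) (w t)
  bound : ∀ t ∈ Icc 0 D.T, sobolevNorm (k + 1) (w t) ≤ M
  lipschitz : ∀ s ∈ Icc 0 D.T, ∀ t ∈ Icc 0 D.T, sobolevNorm (k + 1) (w t - w s) ≤ M * |t - s|

end Data

/-! ### The finite element spaces -/

/-- A partition `0 = x₀ < x₁ < ⋯ < x_nt = 1` of `Ω` into `nt` intervals. -/
structure Mesh where
  nt : ℕ
  x : Fin (nt + 1) → ℝ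
  strictMono : StrictMono x
  first : x 0 = 0
  last : x (Fin.last nt) = 1

namespace Mesh

variable (𝒯 : Mesh)

/-- The mesh size: the largest length of an interval of the partition. -/
def h : ℝ := ⨆ e : Fin 𝒯.nt, (𝒯.x e.succ - 𝒯.x e.castSucc)

/-- `W` is a continuous function on `[0, 1]` vanishing at `0` and `1` and polynomial of degree
at most `k` on each interval of the partition. -/
structure IsFE (k : ℕ) (W : ℝ → ℝ) : Prop where
  cont : ContinuousOn W (Icc 0 1)
  left : W 0 = 0
  right : W 1 = 0
  poly : ∀ e : Fin 𝒯.nt, ∃ p : ℝ[X], p.natDegree ≤ k ∧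
    ∀ y ∈ Icc (𝒯.x e.castSucc) (𝒯.x e.succ), W y = p.eval y

/-- The finite element space `S_h^k`, as a subset of `L₂(Ω)`. -/
def S (k : ℕ) : Set L2 :=
  {u | ∃ W : ℝ → ℝ, 𝒯.IsFE k W ∧ u =ᵐ[volume.restrict (Ioo (0 : ℝ) 1)] W}

/-- Lagrange interpolation nodes of degree `k`: in each interval of the partition, `k + 1`
distinct points which include the two end points. -/
structure Nodes (k : ℕ) where
  P : Fin 𝒯.nt → Fin (k + 1) → ℝ
  strictMono : ∀ e, StrictMono (P e)
  first : ∀ e, P e 0 = 𝒯.x e.castSucc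
  last : ∀ e, P e (Fin.last k) = 𝒯.x e.succ

/-- `V` is the interpolant `I_h u`: the element of `S_h^k` which coincides with `u` at the nodes. -/
def IsInterpolant {k : ℕ} (P : 𝒯.Nodes k) (u : ℝ → ℝ) (V : L2) : Prop :=
  ∃ W : ℝ → ℝ, 𝒯.IsFE k W ∧ (∀ e m, W (P.P e m) = u (P.P e m)) ∧
    V =ᵐ[volume.restrict (Ioo (0 : ℝ) 1)] W

end Mesh

/-! ### The fully discrete scheme -/

/-- One linear Crank–Nicolson step of length `δ` with midpoint `t`, from `V` to `V'`, in which the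
diffusion coefficients are evaluated at `Z`. -/
def CNStep {ne : ℕ} (D : Data ne) (S : Set L2) (δ t : ℝ) (Z V V' : Fin ne → L2) : Prop :=
  (∀ i, V' i ∈ S) ∧
  ∀ i, ∀ W ∈ S,
    inner ℝ (δ⁻¹ • (V' i - V i)) W
      + D.a i (fun j => D.l t (Z j)) * D.b2 t
        * inner ℝ (dy ((1 / 2 : ℝ) • (V' i + V i))) (dy W)
      - D.conv t ((1 / 2 : ℝ) • (V' i + V i)) W = D.source i t W

/-- `V^{(0)}, …, V^{(N)}` is produced by the linearized Crank–Nicolson–Galerkin scheme with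
`N` time steps of length `δ = T / N`; `Vp` is the predicted value `V^{(1,0)}`. -/
structure IsSchemeSolution {ne : ℕ} (D : Data ne) (𝒯 : Mesh) {k : ℕ} (P : 𝒯.Nodes k) (N : ℕ)
    (Vp : Fin ne → L2) (V : ℕ → Fin ne → L2) : Prop where
  initial : ∀ i, 𝒯.IsInterpolant P (D.v0 i) (V 0 i)
  predictor : CNStep D (𝒯.S k) (D.T / N) ((1 / 2) * (D.T / N)) (V 0) (V 0) Vp
  corrector : CNStep D (𝒯.S k) (D.T / N) ((1 / 2) * (D.T / N))
    (fun j => (1 / 2 : ℝ) • (Vp j + V 0 j)) (V 0) (V 1)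
  step : ∀ n : ℕ, 2 ≤ n → n ≤ N →
    CNStep D (𝒯.S k) (D.T / N) ((n - 1 / 2) * (D.T / N))
      (fun j => (3 / 2 : ℝ) • V (n - 1) j - (1 / 2 : ℝ) • V (n - 2) j) (V (n - 1)) (V n)

end CNGalerkin

end

/-!
The proof is the energy method for the linearized Crank–Nicolson–Galerkin scheme, arranged so that
no constant depends on the polynomial degree and no smallness of the time step is needed.

*Space.* On each element the interpolation error has as many zeros as there are nodes. Rolle's
theorem produces a zero of each of its derivatives, and integrating back from these zeros gives the
error bound `h ^ (k + 1) * ‖∂^(k + 1) u‖` with constant one (`IterPrim.sq_le_of_zeros`,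
`Mesh.norm_interpolant_sub_le`). The Ritz projection `r` of `u ∈ H₀¹` is the primitive of the
`L₂` projection of `∂u` onto the discontinuous piecewise polynomials of degree `k - 1`; therefore it
agrees with `u` at the mesh points, and its error is bounded in `L₂` by `h` times the error of the
derivative, without duality (`Mesh.IsRitz.norm_sub_le_pow`). As the estimate is linear in `u`, it
also applies to time increments of the solution.

*One time step.* For the distance `θ` between the discrete solution and the Ritz projection, the
step is tested with the average `W` of the old and the new value. The derivative of the Ritz error
is orthogonal to `∂W`; in the convection term that error is integrated by parts. The convection of
`W` itself contributes `-(γ' / (2 γ)) ‖W‖²`, which is nonpositive since the domain expands, so by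
Poincaré's inequality everything on the right is absorbed in the diffusion term `c ‖∂W‖²`. The result
is `‖θⁿ‖² ≤ ‖θⁿ⁻¹‖² + C δ (h ^ (k + 1) + δ² + η)²`, where `η` bounds the error of the argument of the
coefficients (`energy_step`, `CNStep.norm_sq_le`).

*Conclusion.* For `n ≥ 2` the argument is the extrapolation of earlier levels, so `η` is bounded by
the earlier errors and `δ²`, and an explicit discrete Gronwall argument applies
(`norm_sub_ritz_le`). On the first level the predictor has an error of order `h ^ (k + 1) + δ ^ (3/2)`,
which the factor `δ` in the energy estimate for the corrector turns into the optimal order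
(`norm_sq_first_step_le`).
-/

noncomputable section

namespace CNGalerkin

/-! ### Primitives of integrable functions -/

/-- `w` is a primitive of the integrable function `g` on `[a, b]`; equivalently, `w` is absolutely
continuous there with derivative `g` almost everywhere. -/
structure IsPrim (a b : ℝ) (w g : ℝ → ℝ) : Prop where
  int : IntegrableOn g (Icc a b)
  eq : ∀ x ∈ Icc a b, ∀ y ∈ Icc a b, w y - w x = ∫ t in x..y, g t

namespace IsPrim

variable {a b : ℝ} {u w g q : ℝ → ℝ}

theorem intervalIntegrable (h : IsPrim a b w g) {x y : ℝ} (hx : x ∈ Icc a b) (hy : y ∈ Icc a b) :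
    IntervalIntegrable g volume x y :=
  (h.int.mono_set (uIcc_subset_Icc hx hy)).intervalIntegrable

theorem mono (h : IsPrim a b w g) {c d : ℝ} (hc : a ≤ c) (hd : d ≤ b) : IsPrim c d w g :=
  ⟨h.int.mono_set (Icc_subset_Icc hc hd), fun x hx y hy =>
    h.eq x (Icc_subset_Icc hc hd hx) y (Icc_subset_Icc hc hd hy)⟩

theorem of_integrable (hg : IntegrableOn g (Icc a b)) (c : ℝ) :
    IsPrim a b (fun y => c + ∫ t in a..y, g t) g := by
  refine ⟨hg, fun x hx y hy => ?_⟩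
  have hab : a ≤ b := hx.1.trans hx.2
  have hi : ∀ z ∈ Icc a b, IntervalIntegrable g volume a z := fun z hz =>
    (hg.mono_set (uIcc_subset_Icc ⟨le_rfl, hab⟩ hz)).intervalIntegrable
  rw [← intervalIntegral.integral_interval_sub_left (hi y hy) (hi x hx)]
  ring

theorem const_mul (h : IsPrim a b w g) (c : ℝ) :
    IsPrim a b (fun y => c * w y) (fun y => c * g y) := by
  refine ⟨h.int.const_mul c, fun x hx y hy => ?_⟩
  rw [intervalIntegral.integral_const_mul, ← h.eq x hx y hy]
  ring

theorem sub (h : IsPrim a b w g) (h' : IsPrim a b u q) :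
    IsPrim a b (fun y => w y - u y) (fun y => g y - q y) := by
  refine ⟨h.int.sub h'.int, fun x hx y hy => ?_⟩
  rw [intervalIntegral.integral_sub (h.intervalIntegrable hx hy) (h'.intervalIntegrable hx hy),
    ← h.eq x hx y hy, ← h'.eq x hx y hy]
  ring

theorem congr_ae (h : IsPrim a b w g) (hq : g =ᵐ[volume.restrict (Ioo a b)] q) :
    IsPrim a b w q := by
  have hq' : g =ᵐ[volume.restrict (Icc a b)] q := by
    rwa [Measure.restrict_congr_set Ioo_ae_eq_Icc.symm]
  refine ⟨h.int.congr hq', fun x hx y hy => ?_⟩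
  rw [h.eq x hx y hy]
  apply intervalIntegral.integral_congr_ae
  rw [EventuallyEq, ae_restrict_iff' measurableSet_Icc] at hq'
  filter_upwards [hq'] with z hz hzm
  exact hz (uIcc_subset_Icc hx hy (uIoc_subset_uIcc hzm))

theorem eqOn (h : IsPrim a b w g) (hab : a ≤ b) :
    EqOn w (fun y => w a + ∫ t in a..y, g t) (Icc a b) := fun y hy => by
  have := h.eq a ⟨le_rfl, hab⟩ y hy
  simp only
  linarith

theorem congr (h : IsPrim a b w g) (hu : EqOn w u (Icc a b)) : IsPrim a b u g :=
  ⟨h.int, fun x hx y hy => by rw [← hu hx, ← hu hy]; exact h.eq x hx y hy⟩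

theorem absolutelyContinuous (h : IsPrim a b w g) (hab : a ≤ b) :
    AbsolutelyContinuousOnInterval (fun y => w a + ∫ t in a..y, g t) a b := by
  have h1 := (h.intervalIntegrable ⟨le_rfl, hab⟩ ⟨hab, le_rfl⟩).absolutelyContinuousOnInterval_intervalIntegral
    (c := a) left_mem_uIcc
  have h2 : AbsolutelyContinuousOnInterval (fun _ : ℝ => w a) a b :=
    (LipschitzWith.const (w a)).lipschitzOnWith.absolutelyContinuousOnInterval
  exact h2.add h1

theorem continuousOn (h : IsPrim a b w g) : ContinuousOn w (Icc a b) := by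
  rcases le_or_gt a b with hab | hab
  · have h1 := (h.absolutelyContinuous hab).continuousOn
    rw [uIcc_of_le hab] at h1
    exact h1.congr (h.eqOn hab)
  · simp [Icc_eq_empty_of_lt hab]

theorem ae_hasDerivAt (h : IsPrim a b w g) (hab : a ≤ b) :
    ∀ᵐ x, x ∈ Icc a b → HasDerivAt (fun y => w a + ∫ t in a..y, g t) (g x) x := by
  filter_upwards [(h.intervalIntegrable ⟨le_rfl, hab⟩ ⟨hab, le_rfl⟩).ae_hasDerivAt_integral]
    with x hx hxm
  rw [uIcc_of_le hab] at hx
  exact (hx hxm a ⟨le_rfl, hab⟩).const_add (w a)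

/-- The product rule for absolutely continuous functions. -/
theorem mul (h : IsPrim a b w g) (h' : IsPrim a b u q) :
    IsPrim a b (fun y => w y * u y) (fun y => g y * u y + w y * q y) := by
  refine ⟨(h.int.mul_continuousOn h'.continuousOn isCompact_Icc).add
    (h'.int.continuousOn_mul h.continuousOn isCompact_Icc), fun x hx y hy => ?_⟩
  have hab : a ≤ b := hx.1.trans hx.2
  have hsub : uIcc x y ⊆ uIcc a b := by
    rw [uIcc_of_le hab]; exact uIcc_subset_Icc hx hy
  have key := AbsolutelyContinuousOnInterval.integral_deriv_mul_eq_sub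
    ((h.absolutelyContinuous hab).mono hsub) ((h'.absolutelyContinuous hab).mono hsub)
  have e1 := h.eqOn hab
  have e2 := h'.eqOn hab
  have e1x := e1 hx
  have e1y := e1 hy
  have e2x := e2 hx
  have e2y := e2 hy
  simp only at e1x e1y e2x e2y
  rw [← e1x, ← e1y, ← e2x, ← e2y] at key
  rw [← key]
  apply intervalIntegral.integral_congr_ae
  filter_upwards [h.ae_hasDerivAt hab, h'.ae_hasDerivAt hab] with z hz hz' hzm
  have hzI : z ∈ Icc a b := uIcc_subset_Icc hx hy (uIoc_subset_uIcc hzm)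
  rw [(hz hzI).deriv, (hz' hzI).deriv]
  have e1z := e1 hzI
  have e2z := e2 hzI
  simp only at e1z e2z
  rw [← e1z, ← e2z]

/-- A function which is continuous on `[a, b]` and differentiable off a countable set is a primitive
of its derivative, provided that the latter is integrable. -/
theorem of_hasDerivAt {s : Set ℝ} (hs : s.Countable) (hc : ContinuousOn w (Icc a b))
    (hd : ∀ x ∈ Ioo a b \ s, HasDerivAt w (g x) x) (hg : IntegrableOn g (Icc a b)) :
    IsPrim a b w g := by
  have key : ∀ x ∈ Icc a b, ∀ y ∈ Icc a b, x ≤ y → ∫ t in x..y, g t = w y - w x := by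
    intro x hx y hy hxy
    refine integral_eq_of_hasDerivAt_off_countable_of_le w g hxy hs
      (hc.mono (Icc_subset_Icc hx.1 hy.2)) (fun z hz => hd z ⟨?_, hz.2⟩)
      (hg.mono_set (uIcc_subset_Icc hx hy)).intervalIntegrable
    exact Ioo_subset_Ioo hx.1 hy.2 hz.1
  refine ⟨hg, fun x hx y hy => ?_⟩
  rcases le_total x y with hxy | hxy
  · exact (key x hx y hy hxy).symm
  · rw [intervalIntegral.integral_symm, key y hy x hx hxy]
    ring

theorem of_contDiff (hw : ContDiff ℝ 1 w) : IsPrim a b w (deriv w) :=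
  of_hasDerivAt countable_empty hw.continuous.continuousOn
    (fun x _ => (hw.differentiable (by norm_num) x).hasDerivAt)
    ((hw.continuous_deriv le_rfl).continuousOn.integrableOn_compact isCompact_Icc)

/-- A primitive of a continuous function is differentiable. -/
theorem hasDerivAt (h : IsPrim a b w g) (hg : ContinuousOn g (Icc a b)) {x : ℝ}
    (hx : x ∈ Ioo a b) : HasDerivAt w (g x) x := by
  have hxI := Ioo_subset_Icc_self hx
  have hab : a ≤ b := hxI.1.trans hxI.2
  have hnhds : Icc a b ∈ 𝓝 x := Icc_mem_nhds hx.1 hx.2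
  have h1 : HasDerivAt (fun y => ∫ t in a..y, g t) (g x) x :=
    intervalIntegral.integral_hasDerivAt_right (h.intervalIntegrable ⟨le_rfl, hab⟩ hxI)
      ((hg.mono Ioo_subset_Icc_self).stronglyMeasurableAtFilter isOpen_Ioo x hx)
      (hg.continuousAt hnhds)
  refine (h1.const_add (w a)).congr_of_eventuallyEq ?_
  filter_upwards [hnhds] with y hy
  exact h.eqOn hab hy

theorem integral_Ioo (h : IsPrim a b w g) (hab : a ≤ b) : ∫ y in Ioo a b, g y = w b - w a := by
  rw [h.eq a ⟨le_rfl, hab⟩ b ⟨hab, le_rfl⟩, intervalIntegral.integral_of_le hab,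
    integral_Ioc_eq_integral_Ioo]

end IsPrim

/-! ### Weak derivatives -/

theorem HasWeakDeriv.congr {a b : ℝ} {u g u' g' : ℝ → ℝ} (h : HasWeakDeriv a b u g)
    (hu : u =ᵐ[volume.restrict (Ioo a b)] u') (hg : g =ᵐ[volume.restrict (Ioo a b)] g') :
    HasWeakDeriv a b u' g' := by
  intro φ h1 h2 h3
  have e1 : ∫ y in Ioo a b, u' y * deriv φ y = ∫ y in Ioo a b, u y * deriv φ y :=
    integral_congr_ae (hu.mono fun y hy => by simp only [hy])
  have e2 : ∫ y in Ioo a b, g' y * φ y = ∫ y in Ioo a b, g y * φ y :=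
    integral_congr_ae (hg.mono fun y hy => by simp only [hy])
  rw [e1, e2]
  exact h φ h1 h2 h3

theorem IsPrim.hasWeakDeriv {a b : ℝ} {w g : ℝ → ℝ} (h : IsPrim a b w g) (hab : a ≤ b) :
    HasWeakDeriv a b w g := by
  intro φ h1 h2 h3
  have hφ : ContDiff ℝ 1 φ := h1.of_le (by exact_mod_cast le_top)
  have hm := h.mul (of_contDiff (a := a) (b := b) hφ)
  have key := hm.integral_Ioo hab
  have hz : ∀ y, y ∉ Ioo a b → φ y = 0 := fun y hy => by
    by_contra hne
    exact hy (h3 (subset_tsupport φ hne))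
  rw [hz a (by simp), hz b (by simp)] at key
  have i1 : IntegrableOn (fun y => g y * φ y) (Ioo a b) :=
    (h.int.mul_continuousOn hφ.continuous.continuousOn isCompact_Icc).mono_set Ioo_subset_Icc_self
  have i2 : IntegrableOn (fun y => w y * deriv φ y) (Ioo a b) :=
    ((h.continuousOn.mul (hφ.continuous_deriv le_rfl).continuousOn).integrableOn_compact
      isCompact_Icc).mono_set Ioo_subset_Icc_self
  rw [integral_add i1 i2] at key
  linarith

/-- The du Bois-Reymond lemma on `(0, 1)`: a function with vanishing weak derivative is constant. -/
theorem ae_const_of_hasWeakDeriv_zero {u : ℝ → ℝ} (hu : IntegrableOn u (Ioo 0 1))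
    (h : HasWeakDeriv 0 1 u 0) : ∃ c : ℝ, u =ᵐ[volume.restrict (Ioo (0 : ℝ) 1)] fun _ => c := by
  -- a fixed test function of integral one; every other test function is, up to a multiple of it,
  -- the derivative of a test function
  let B : ContDiffBump (1 / 2 : ℝ) := ⟨1 / 8, 1 / 4, by norm_num, by norm_num⟩
  let ψ : ℝ → ℝ := B.normed volume
  have hψs : ContDiff ℝ ∞ ψ := B.contDiff_normed
  have hψc : HasCompactSupport ψ := B.hasCompactSupport_normed
  have hψt : tsupport ψ ⊆ Icc (1 / 4) (3 / 4) := by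
    rw [B.tsupport_normed_eq, Real.closedBall_eq_Icc]
    apply Icc_subset_Icc <;> norm_num [B]
  have hψ1 : ∫ y, ψ y = 1 := B.integral_normed
  have hint : ∀ {φ : ℝ → ℝ}, ContDiff ℝ ∞ φ → HasCompactSupport φ →
      IntegrableOn (fun y => u y * φ y) (Ioo (0 : ℝ) 1) := by
    intro φ h1 h2
    obtain ⟨K, hK⟩ := h2.exists_bound_of_continuous h1.continuous
    exact Integrable.mul_bdd hu h1.continuous.aestronglyMeasurable (Eventually.of_forall hK)
  refine ⟨∫ y in Ioo (0 : ℝ) 1, u y * ψ y, ?_⟩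
  set c := ∫ y in Ioo (0 : ℝ) 1, u y * ψ y with hc
  have hcint : IntegrableOn (fun y => u y - c) (Ioo 0 1) := hu.sub (integrable_const c)
  have key : ∀ᵐ y ∂(volume : Measure ℝ), y ∈ Ioo (0 : ℝ) 1 → u y - c = 0 := by
    refine isOpen_Ioo.ae_eq_zero_of_integral_contDiff_smul_eq_zero
      (f := fun y => u y - c) hcint.locallyIntegrableOn ?_
    intro η hη hηc hηs
    obtain ⟨a, b, ha, hb, hab, hηab⟩ : ∃ a b : ℝ, 0 < a ∧ b < 1 ∧ a ≤ b ∧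
        tsupport η ⊆ Icc a b := by
      rcases (tsupport η).eq_empty_or_nonempty with he | hne
      · exact ⟨1 / 2, 1 / 2, by norm_num, by norm_num, le_rfl, by simp [he]⟩
      · have hK : IsCompact (tsupport η) := hηc
        exact ⟨sInf (tsupport η), sSup (tsupport η), (hηs (hK.sInf_mem hne)).1,
          (hηs (hK.sSup_mem hne)).2, csInf_le hK.bddBelow (hK.sSup_mem hne),
          fun x hx => ⟨csInf_le hK.bddBelow hx, le_csSup hK.bddAbove hx⟩⟩
    set m := ∫ y, η y with hm
    let ζ : ℝ → ℝ := fun y => η y - m * ψ y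
    have hζs : ContDiff ℝ ∞ ζ := hη.sub (contDiff_const.mul hψs)
    have hζi : Integrable ζ := (hη.continuous.integrable_of_hasCompactSupport hηc).sub
      ((hψs.continuous.integrable_of_hasCompactSupport hψc).const_mul m)
    have hζ0 : ∫ y, ζ y = 0 := by
      rw [integral_sub (hη.continuous.integrable_of_hasCompactSupport hηc)
        ((hψs.continuous.integrable_of_hasCompactSupport hψc).const_mul m),
        integral_const_mul, hψ1, ← hm]
      ring
    have hζz : ∀ y, y ∉ Icc (min a (1 / 4)) (max b (3 / 4)) → ζ y = 0 := by
      intro y hy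
      have h1 : η y = 0 := by
        by_contra hne
        have := hηab (subset_tsupport η hne)
        exact hy ⟨(min_le_left _ _).trans this.1, this.2.trans (le_max_left _ _)⟩
      have h2 : ψ y = 0 := by
        by_contra hne
        have := hψt (subset_tsupport ψ hne)
        exact hy ⟨(min_le_right _ _).trans this.1, this.2.trans (le_max_right _ _)⟩
      simp [ζ, h1, h2]
    let φ : ℝ → ℝ := fun y => ∫ t in (0 : ℝ)..y, ζ t
    have hφd : ∀ y, HasDerivAt φ (ζ y) y := fun y =>
      intervalIntegral.integral_hasDerivAt_right (hζi.intervalIntegrable)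
        hζs.continuous.stronglyMeasurable.stronglyMeasurableAtFilter hζs.continuous.continuousAt
    have hφderiv : deriv φ = ζ := funext fun y => (hφd y).deriv
    have hφs : ContDiff ℝ ∞ φ := by
      rw [contDiff_infty_iff_deriv, hφderiv]
      exact ⟨fun y => (hφd y).differentiableAt, hζs⟩
    have hφz : ∀ y, y ∉ Icc (min a (1 / 4)) (max b (3 / 4)) → φ y = 0 := by
      intro y hy
      have hmin : 0 < min a (1 / 4) := lt_min ha (by norm_num)
      rw [mem_Icc, not_and_or, not_le, not_le] at hy
      rcases hy with hy | hy
      · refine intervalIntegral.integral_zero_ae (Eventually.of_forall fun t ht => hζz t ?_)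
        intro htm
        have := (uIoc_subset_uIcc ht)
        rw [mem_uIcc] at this
        rcases this with h' | h' <;> linarith [htm.1, h'.1, h'.2]
      · have hmm : min a (1 / 4) ≤ max b (3 / 4) :=
          (min_le_right _ _).trans (le_trans (by norm_num) (le_max_right _ _))
        have hy0 : 0 ≤ y := by linarith
        have : ∫ t in (0 : ℝ)..y, ζ t = ∫ t, ζ t := by
          rw [intervalIntegral.integral_of_le hy0]
          refine setIntegral_eq_integral_of_forall_compl_eq_zero fun t ht => hζz t fun htm => ht ?_
          exact ⟨by linarith [htm.1], by linarith [htm.2]⟩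
        simp only [φ, this, hζ0]
    have hφt : tsupport φ ⊆ Icc (min a (1 / 4)) (max b (3 / 4)) :=
      closure_minimal (fun y hy => by
        by_contra hne
        exact hy (hφz y hne)) isClosed_Icc
    have hφc : HasCompactSupport φ := HasCompactSupport.of_support_subset_isCompact isCompact_Icc
      ((subset_tsupport φ).trans hφt)
    have h0 := h φ hφs hφc (hφt.trans fun y hy => ⟨lt_of_lt_of_le (lt_min ha (by norm_num)) hy.1,
      lt_of_le_of_lt hy.2 (max_lt hb (by norm_num))⟩)
    simp only [hφderiv, Pi.zero_apply, zero_mul, integral_zero, neg_zero] at h0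
    have hηIoo : ∫ y in Ioo (0 : ℝ) 1, η y = m :=
      setIntegral_eq_integral_of_forall_compl_eq_zero fun t ht => by
        by_contra hne
        exact ht (hηs (subset_tsupport η hne))
    have h1 : ∫ y in Ioo (0 : ℝ) 1, u y * ζ y = (∫ y in Ioo (0 : ℝ) 1, u y * η y) - m * c := by
      rw [hc, ← integral_const_mul, ← integral_sub (hint hη hηc) ((hint hψs hψc).const_mul m)]
      refine integral_congr_ae (Eventually.of_forall fun y => ?_)
      simp only [ζ]
      ring
    have h2 : ∫ y in Ioo (0 : ℝ) 1, (u y - c) * η y = 0 := by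
      have : ∀ y, (u y - c) * η y = u y * η y - c * η y := fun y => by ring
      simp only [this]
      rw [integral_sub (hint hη hηc)
        ((hη.continuous.integrable_of_hasCompactSupport hηc).integrableOn.const_mul c),
        integral_const_mul, hηIoo]
      linarith
    rw [← h2]
    refine (setIntegral_eq_integral_of_forall_compl_eq_zero (s := Ioo (0 : ℝ) 1)
      fun y hy => ?_).symm.trans ?_
    · have : η y = 0 := by
        by_contra hne
        exact hy (hηs (subset_tsupport η hne))
      simp [this]
    · refine integral_congr_ae (Eventually.of_forall fun y => ?_)
      simp only [smul_eq_mul]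
      ring
  rw [EventuallyEq, ae_restrict_iff' measurableSet_Ioo]
  filter_upwards [key] with y hy hm
  exact sub_eq_zero.mp (hy hm)

theorem L2.integrableOn (q : L2) : IntegrableOn (q : ℝ → ℝ) (Ioo (0 : ℝ) 1) :=
  (Lp.memLp q).integrable (by norm_num)

theorem L2.integrableOn_Icc (q : L2) : IntegrableOn (q : ℝ → ℝ) (Icc (0 : ℝ) 1) := by
  rw [integrableOn_Icc_iff_integrableOn_Ioo]
  exact q.integrableOn

/-- An element of `H¹(Ω)` has an absolutely continuous representative. -/
theorem HasWeakDeriv.exists_isPrim {u g : ℝ → ℝ} (hu : IntegrableOn u (Ioo 0 1))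
    (hg : IntegrableOn g (Ioo 0 1)) (h : HasWeakDeriv 0 1 u g) :
    ∃ w : ℝ → ℝ, IsPrim 0 1 w g ∧ u =ᵐ[volume.restrict (Ioo (0 : ℝ) 1)] w := by
  have hg' : IntegrableOn g (Icc 0 1) := by rwa [integrableOn_Icc_iff_integrableOn_Ioo]
  have hp := IsPrim.of_integrable hg' 0
  set p : ℝ → ℝ := fun y => 0 + ∫ t in (0 : ℝ)..y, g t with hpdef
  have hpi : IntegrableOn p (Ioo 0 1) :=
    (hp.continuousOn.integrableOn_compact isCompact_Icc).mono_set Ioo_subset_Icc_self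
  have hpw := hp.hasWeakDeriv zero_le_one
  have hd : HasWeakDeriv 0 1 (fun y => u y - p y) 0 := by
    intro φ h1 h2 h3
    have hφ : ContDiff ℝ 1 φ := h1.of_le (by exact_mod_cast le_top)
    obtain ⟨K, hK⟩ := h2.deriv.exists_bound_of_continuous (hφ.continuous_deriv le_rfl)
    have hi : ∀ {q : ℝ → ℝ}, IntegrableOn q (Ioo 0 1) →
        IntegrableOn (fun y => q y * deriv φ y) (Ioo 0 1) := fun hq =>
      Integrable.mul_bdd hq (hφ.continuous_deriv le_rfl).aestronglyMeasurable
        (Eventually.of_forall hK)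
    have e : ∀ y, (u y - p y) * deriv φ y = u y * deriv φ y - p y * deriv φ y := fun y => by ring
    simp only [e, Pi.zero_apply, zero_mul, integral_zero, neg_zero]
    rw [integral_sub (hi hu) (hi hpi), h φ h1 h2 h3, hpw φ h1 h2 h3]
    ring
  obtain ⟨c, hc⟩ := ae_const_of_hasWeakDeriv_zero (hu.sub hpi) hd
  refine ⟨fun y => c + ∫ t in (0 : ℝ)..y, g t, IsPrim.of_integrable hg' c, ?_⟩
  filter_upwards [hc] with y hy
  simp only [hpdef, Pi.sub_apply] at hy
  linarith

/-! ### The spaces `H¹(Ω)` and `H₀¹(Ω)` -/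

theorem exists_isPrim_dy {u g : L2} (h : HasWeakDeriv 0 1 u g) :
    ∃ w : ℝ → ℝ, IsPrim 0 1 w (dy u) ∧ u =ᵐ[volume.restrict (Ioo (0 : ℝ) 1)] w := by
  rw [dy_eq h]
  exact h.exists_isPrim u.integrableOn g.integrableOn

theorem dy_eq_of_isPrim {u g : L2} {w : ℝ → ℝ} (hw : IsPrim 0 1 w g)
    (hu : u =ᵐ[volume.restrict (Ioo (0 : ℝ) 1)] w) : HasWeakDeriv 0 1 u g ∧ dy u = g := by
  have h := (hw.hasWeakDeriv zero_le_one).congr hu.symm (ae_eq_refl _)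
  exact ⟨h, dy_eq h⟩

theorem hasWeakDeriv_sub {u u' g g' : L2} (h : HasWeakDeriv 0 1 u g) (h' : HasWeakDeriv 0 1 u' g') :
    HasWeakDeriv 0 1 (u - u' : L2) (g - g' : L2) := by
  obtain ⟨w, hw, huw⟩ := h.exists_isPrim u.integrableOn g.integrableOn
  obtain ⟨w', hw', huw'⟩ := h'.exists_isPrim u'.integrableOn g'.integrableOn
  refine ((hw.sub hw').hasWeakDeriv zero_le_one).congr ?_ (Lp.coeFn_sub g g').symm
  filter_upwards [huw, huw', Lp.coeFn_sub u u'] with y h1 h2 h3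
  rw [h3, Pi.sub_apply, h1, h2]

theorem hasWeakDeriv_smul {u g : L2} (c : ℝ) (h : HasWeakDeriv 0 1 u g) :
    HasWeakDeriv 0 1 (c • u : L2) (c • g : L2) := by
  obtain ⟨w, hw, huw⟩ := h.exists_isPrim u.integrableOn g.integrableOn
  refine ((hw.const_mul c).hasWeakDeriv zero_le_one).congr ?_ ?_
  · filter_upwards [huw, Lp.coeFn_smul c u] with y h1 h3
    rw [h3, Pi.smul_apply, h1, smul_eq_mul]
  · filter_upwards [Lp.coeFn_smul c g] with y h3
    rw [h3, Pi.smul_apply, smul_eq_mul]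

theorem eqOn_Icc_of_ae_eq {w w' : ℝ → ℝ} (hw : ContinuousOn w (Icc 0 1))
    (hw' : ContinuousOn w' (Icc 0 1)) (h : w =ᵐ[volume.restrict (Ioo (0 : ℝ) 1)] w') :
    EqOn w w' (Icc 0 1) := by
  refine Measure.eqOn_Icc_of_ae_eq volume zero_ne_one ?_ hw hw'
  rwa [Measure.restrict_congr_set Ioo_ae_eq_Icc.symm]

theorem exists_isPrim_of_mem_H01 {u : L2} (hu : u ∈ H01) :
    ∃ w : ℝ → ℝ, IsPrim 0 1 w (dy u) ∧ u =ᵐ[volume.restrict (Ioo (0 : ℝ) 1)] w ∧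
      w 0 = 0 ∧ w 1 = 0 := by
  obtain ⟨w, hw, huw⟩ := hu
  obtain ⟨g, hg, hwg⟩ := hw.weak
  have h : HasWeakDeriv 0 1 u (hg.toLp g) := hwg.congr huw.symm hg.coeFn_toLp.symm
  obtain ⟨w', hw', huw'⟩ := exists_isPrim_dy h
  have he : EqOn w' w (Icc 0 1) := eqOn_Icc_of_ae_eq hw'.continuousOn hw.cont (huw'.symm.trans huw)
  exact ⟨w, hw'.congr he, huw, hw.left, hw.right⟩

theorem mem_H01_of_isPrim {u g : L2} {w : ℝ → ℝ} (hw : IsPrim 0 1 w g)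
    (hu : u =ᵐ[volume.restrict (Ioo (0 : ℝ) 1)] w) (h0 : w 0 = 0) (h1 : w 1 = 0) : u ∈ H01 :=
  ⟨w, ⟨hw.continuousOn, h0, h1, g, Lp.memLp g, hw.hasWeakDeriv zero_le_one⟩, hu⟩

theorem hasWeakDeriv_of_mem_H01 {u : L2} (hu : u ∈ H01) : HasWeakDeriv 0 1 u (dy u) := by
  obtain ⟨w, hw, huw, -, -⟩ := exists_isPrim_of_mem_H01 hu
  exact (dy_eq_of_isPrim hw huw).1

theorem dy_sub {u u' : L2} (hu : u ∈ H01) (hu' : u' ∈ H01) : dy (u - u') = dy u - dy u' :=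
  dy_eq (hasWeakDeriv_sub (hasWeakDeriv_of_mem_H01 hu) (hasWeakDeriv_of_mem_H01 hu'))

theorem dy_smul {u : L2} (c : ℝ) (hu : u ∈ H01) : dy (c • u) = c • dy u :=
  dy_eq (hasWeakDeriv_smul c (hasWeakDeriv_of_mem_H01 hu))

theorem H01_sub {u u' : L2} (hu : u ∈ H01) (hu' : u' ∈ H01) : u - u' ∈ H01 := by
  obtain ⟨w, hw, huw, h0, h1⟩ := exists_isPrim_of_mem_H01 hu
  obtain ⟨w', hw', huw', h0', h1'⟩ := exists_isPrim_of_mem_H01 hu'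
  refine mem_H01_of_isPrim (g := dy u - dy u')
    ((hw.sub hw').congr_ae (Lp.coeFn_sub (dy u) (dy u')).symm) ?_ (by simp [h0, h0'])
    (by simp [h1, h1'])
  filter_upwards [huw, huw', Lp.coeFn_sub u u'] with y e1 e2 e3
  rw [e3, Pi.sub_apply, e1, e2]

theorem H01_smul {u : L2} (c : ℝ) (hu : u ∈ H01) : c • u ∈ H01 := by
  obtain ⟨w, hw, huw, h0, h1⟩ := exists_isPrim_of_mem_H01 hu
  refine mem_H01_of_isPrim (g := c • dy u)
    ((hw.const_mul c).congr_ae (Lp.coeFn_smul c (dy u)).symm) ?_ (by simp [h0]) (by simp [h1])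
  filter_upwards [huw, Lp.coeFn_smul c u] with y e1 e3
  rw [e3, Pi.smul_apply, e1, smul_eq_mul]

theorem H01_add {u u' : L2} (hu : u ∈ H01) (hu' : u' ∈ H01) : u + u' ∈ H01 := by
  have := H01_sub hu (H01_smul (-1) hu')
  simpa using this

theorem dy_add {u u' : L2} (hu : u ∈ H01) (hu' : u' ∈ H01) : dy (u + u') = dy u + dy u' := by
  have := dy_sub hu (H01_smul (-1) hu')
  rw [dy_smul _ hu'] at this
  simpa using this

/-! ### Estimates in `L₂` -/

theorem L2.inner_eq (u w : L2) : inner ℝ u w = ∫ y in Ioo (0 : ℝ) 1, u y * w y := by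
  rw [L2.inner_def]
  refine integral_congr_ae (Eventually.of_forall fun y => ?_)
  simp [mul_comm]

theorem L2.norm_sq_eq (u : L2) : ‖u‖ ^ 2 = ∫ y in Ioo (0 : ℝ) 1, u y ^ 2 := by
  rw [← real_inner_self_eq_norm_sq, L2.inner_eq]
  simp only [sq]

theorem L2.integrableOn_sq (u : L2) : IntegrableOn (fun y => u y ^ 2) (Icc 0 1) := by
  rw [integrableOn_Icc_iff_integrableOn_Ioo]
  exact (Lp.memLp u).integrable_sq

theorem L2.integrableOn_mul (u w : L2) : IntegrableOn (fun y => u y * w y) (Ioo 0 1) :=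
  (Lp.memLp u).integrable_mul (Lp.memLp w)

/-- The Cauchy–Schwarz inequality against the constant function. -/
theorem sq_intervalIntegral_le {g : ℝ → ℝ} {x y : ℝ} (hxy : x ≤ y)
    (hg : IntegrableOn g (Icc x y)) (hg2 : IntegrableOn (fun t => g t ^ 2) (Icc x y)) :
    (∫ t in x..y, g t) ^ 2 ≤ (y - x) * ∫ t in Icc x y, g t ^ 2 := by
  rcases hxy.eq_or_lt with rfl | hlt
  · simp
  rw [intervalIntegral.integral_of_le hxy, ← integral_Icc_eq_integral_Ioc]
  set I := ∫ t in Icc x y, g t with hI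
  -- the variance of `g` about its mean `m` is nonnegative
  set m := I / (y - x) with hm
  have hpos : 0 < y - x := sub_pos.mpr hlt
  have h0 : 0 ≤ ∫ t in Icc x y, (g t - m) ^ 2 := integral_nonneg fun t => sq_nonneg _
  have e : ∀ t, (g t - m) ^ 2 = g t ^ 2 - 2 * m * g t + m ^ 2 := fun t => by ring
  simp only [e] at h0
  have hc : IntegrableOn (fun _ : ℝ => m ^ 2) (Icc x y) := integrableOn_const (by simp)
  have hs : IntegrableOn (fun t => g t ^ 2 - 2 * m * g t) (Icc x y) :=
    hg2.sub (hg.const_mul (2 * m))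
  rw [integral_add hs hc, integral_sub hg2 (hg.const_mul (2 * m)),
    integral_const_mul, ← hI] at h0
  simp only [integral_const, measureReal_restrict_apply MeasurableSet.univ, univ_inter,
    Real.volume_real_Icc_of_le hxy, smul_eq_mul] at h0
  have e2 : m * (y - x) = I := by rw [hm]; field_simp
  have e3 : 0 ≤ (∫ t in Icc x y, g t ^ 2) - m * I := by
    have : m ^ 2 * (y - x) = m * I := by rw [← e2]; ring
    nlinarith
  have e4 : I ^ 2 = (y - x) * (m * I) := by rw [← mul_assoc, mul_comm (y - x) m, e2]; ring
  rw [e4]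
  exact mul_le_mul_of_nonneg_left (by linarith) hpos.le

/-- The Poincaré inequality on `(0, 1)`. -/
theorem norm_le_norm_dy {u : L2} (hu : u ∈ H01) : ‖u‖ ≤ ‖dy u‖ := by
  obtain ⟨w, hw, huw, h0, -⟩ := exists_isPrim_of_mem_H01 hu
  have hb : ∀ y ∈ Icc (0 : ℝ) 1, w y ^ 2 ≤ ‖dy u‖ ^ 2 := by
    intro y hy
    have h01 : (0 : ℝ) ∈ Icc (0 : ℝ) 1 := ⟨le_rfl, zero_le_one⟩
    have hsub : Icc 0 y ⊆ Icc (0 : ℝ) 1 := Icc_subset_Icc le_rfl hy.2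
    have e := hw.eq 0 h01 y hy
    rw [h0, sub_zero] at e
    rw [e]
    refine (sq_intervalIntegral_le hy.1 (hw.int.mono_set hsub)
      ((dy u).integrableOn_sq.mono_set hsub)).trans ?_
    have h1 : ∫ t in Icc 0 y, (dy u : ℝ → ℝ) t ^ 2 ≤ ‖dy u‖ ^ 2 := by
      rw [L2.norm_sq_eq, ← integral_Icc_eq_integral_Ioo]
      exact setIntegral_mono_set (dy u).integrableOn_sq
        (Eventually.of_forall fun t => sq_nonneg _) hsub.eventuallyLE
    have h2 : 0 ≤ ∫ t in Icc 0 y, (dy u : ℝ → ℝ) t ^ 2 := integral_nonneg fun t => sq_nonneg _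
    nlinarith [hy.1, hy.2]
  refine le_of_sq_le_sq ?_ (norm_nonneg _)
  rw [L2.norm_sq_eq u]
  have e1 : ∫ y in Ioo (0 : ℝ) 1, (u : ℝ → ℝ) y ^ 2 ≤ ∫ y in Ioo (0 : ℝ) 1, ‖dy u‖ ^ 2 := by
    refine integral_mono_ae (u.integrableOn_sq.mono_set Ioo_subset_Icc_self)
      (integrableOn_const (by simp)) ?_
    filter_upwards [huw, ae_restrict_mem measurableSet_Ioo] with y hy hym
    rw [hy]
    exact hb y (Ioo_subset_Icc_self hym)
  simpa using e1

/-- Integration by parts against an affine coefficient. -/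
theorem integral_affine_mul {u w : L2} (hu : u ∈ H01) (hw : w ∈ H01) (c d : ℝ) :
    (∫ y in Ioo (0 : ℝ) 1, (c + d * y) * dy u y * w y)
      + (∫ y in Ioo (0 : ℝ) 1, (c + d * y) * dy w y * u y) = - d * inner ℝ u w := by
  obtain ⟨p, hp, hup, hp0, hp1⟩ := exists_isPrim_of_mem_H01 hu
  obtain ⟨q, hq, hwq, hq0, hq1⟩ := exists_isPrim_of_mem_H01 hw
  have hb : IsPrim 0 1 (fun y => c + d * y) (fun _ => d) := by
    refine IsPrim.of_hasDerivAt countable_empty (by fun_prop) (fun x _ => ?_)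
      (integrableOn_const (by simp))
    simpa using ((hasDerivAt_id x).const_mul d).const_add c
  have key := (hb.mul (hp.mul hq)).integral_Ioo zero_le_one
  simp only [hp0, hp1, zero_mul, mul_zero, sub_zero] at key
  have hbc : ContinuousOn (fun y : ℝ => c + d * y) (Icc 0 1) := by fun_prop
  have i1 : IntegrableOn (fun y => (c + d * y) * dy u y * q y) (Ioo 0 1) := by
    rw [← integrableOn_Icc_iff_integrableOn_Ioo]
    exact (hp.int.continuousOn_mul hbc isCompact_Icc).mul_continuousOn hq.continuousOn isCompact_Icc
  have i2 : IntegrableOn (fun y => (c + d * y) * dy w y * p y) (Ioo 0 1) := by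
    rw [← integrableOn_Icc_iff_integrableOn_Ioo]
    exact (hq.int.continuousOn_mul hbc isCompact_Icc).mul_continuousOn hp.continuousOn isCompact_Icc
  have i3 : IntegrableOn (fun y => d * (p y * q y)) (Ioo 0 1) := by
    rw [← integrableOn_Icc_iff_integrableOn_Ioo]
    exact ((hp.continuousOn.mul hq.continuousOn).integrableOn_compact isCompact_Icc).const_mul d
  have e1 : ∫ y in Ioo (0 : ℝ) 1, (c + d * y) * dy u y * w y
      = ∫ y in Ioo (0 : ℝ) 1, (c + d * y) * dy u y * q y :=
    integral_congr_ae (hwq.mono fun y hy => by simp only [hy])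
  have e2 : ∫ y in Ioo (0 : ℝ) 1, (c + d * y) * dy w y * u y
      = ∫ y in Ioo (0 : ℝ) 1, (c + d * y) * dy w y * p y :=
    integral_congr_ae (hup.mono fun y hy => by simp only [hy])
  have e3 : inner ℝ u w = ∫ y in Ioo (0 : ℝ) 1, p y * q y := by
    rw [L2.inner_eq]
    refine integral_congr_ae ?_
    filter_upwards [hup, hwq] with y h1 h2
    rw [h1, h2]
  rw [e1, e2, e3, ← integral_add i1 i2, ← integral_const_mul]
  have e4 : ∀ y, d * (p y * q y) + (c + d * y) * (dy u y * q y + p y * dy w y)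
      = d * (p y * q y) + ((c + d * y) * dy u y * q y + (c + d * y) * dy w y * p y) :=
    fun y => by ring
  simp only [e4] at key
  have i12 : IntegrableOn (fun y => (c + d * y) * dy u y * q y + (c + d * y) * dy w y * p y)
      (Ioo 0 1) := i1.add i2
  rw [integral_add i3 i12, integral_const_mul] at key
  rw [integral_const_mul]
  linarith

/-! ### Higher Sobolev regularity -/

theorem MemH.sub : ∀ {m : ℕ} {u w : L2}, MemH m u → MemH m w → MemH m (u - w)
  | 0, _, _, _, _ => trivial
  | _ + 1, _, _, ⟨g, hg, hgm⟩, ⟨g', hg', hgm'⟩ => ⟨g - g', hasWeakDeriv_sub hg hg', hgm.sub hgm'⟩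

theorem norm_dy_iterate_le (m : ℕ) {j : ℕ} (hj : j ≤ m) (u : L2) :
    ‖dy^[j] u‖ ≤ sobolevNorm m u := by
  refine Real.le_sqrt_of_sq_le ?_
  exact Finset.single_le_sum (f := fun j => ‖dy^[j] u‖ ^ 2) (fun i _ => sq_nonneg _)
    (Finset.mem_range.mpr (by omega))

/-- `w` is a `(k + 1)`-fold primitive of `G` on `[a, b]`, that is, a `C^k` function whose derivative
of order `k` is absolutely continuous with derivative `G`. -/
def IterPrim (a b : ℝ) : ℕ → (ℝ → ℝ) → (ℝ → ℝ) → Prop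
  | 0, w, G => IsPrim a b w G
  | k + 1, w, G => ∃ w' : ℝ → ℝ, IsPrim a b w w' ∧ IterPrim a b k w' G

theorem IterPrim.continuousOn {a b : ℝ} {k : ℕ} {w G : ℝ → ℝ} (h : IterPrim a b k w G) :
    ContinuousOn w (Icc a b) := by
  cases k with
  | zero => exact IsPrim.continuousOn h
  | succ k => exact h.choose_spec.1.continuousOn

theorem IterPrim.mono {a b c d : ℝ} (hc : a ≤ c) (hd : d ≤ b) :
    ∀ {k : ℕ} {w G : ℝ → ℝ}, IterPrim a b k w G → IterPrim c d k w G
  | 0, _, _, h => IsPrim.mono h hc hd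
  | _ + 1, _, _, ⟨w', h, h'⟩ => ⟨w', h.mono hc hd, h'.mono hc hd⟩

theorem exists_iterPrim : ∀ {k : ℕ} {u : L2}, MemH (k + 1) u →
    ∃ w : ℝ → ℝ, IterPrim 0 1 k w (dy^[k + 1] u) ∧ u =ᵐ[volume.restrict (Ioo (0 : ℝ) 1)] w
  | 0, _, ⟨_, hg, _⟩ => exists_isPrim_dy hg
  | k + 1, u, ⟨g, hg, hgm⟩ => by
    obtain ⟨w', hw', hgw'⟩ := exists_iterPrim hgm
    obtain ⟨w, hw, huw⟩ := exists_isPrim_dy hg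
    rw [dy_eq hg] at hw
    refine ⟨w, ⟨w', hw.congr_ae hgw', ?_⟩, huw⟩
    rw [Function.iterate_succ_apply, dy_eq hg]
    exact hw'

theorem IsPrim.sub_polynomial {a b : ℝ} {w g : ℝ → ℝ} (h : IsPrim a b w g) (p : ℝ[X]) :
    IsPrim a b (fun y => w y - p.eval y) (fun y => g y - p.derivative.eval y) :=
  h.sub (IsPrim.of_hasDerivAt countable_empty p.continuous.continuousOn
    (fun x _ => p.hasDerivAt x) (p.derivative.continuous.continuousOn.integrableOn_compact
      isCompact_Icc))

theorem IterPrim.sub_polynomial {a b : ℝ} : ∀ {k : ℕ} {w G : ℝ → ℝ}, IterPrim a b k w G →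
    ∀ p : ℝ[X], p.natDegree ≤ k → IterPrim a b k (fun y => w y - p.eval y) G
  | 0, w, G, h, p, hp => by
    have h1 := IsPrim.sub_polynomial h p
    rw [Polynomial.derivative_of_natDegree_zero (Nat.le_zero.mp hp)] at h1
    simpa [IterPrim] using h1
  | _ + 1, _, _, ⟨_, h, h'⟩, p, hp =>
    ⟨_, h.sub_polynomial p, h'.sub_polynomial p.derivative
      ((p.natDegree_derivative_le).trans (by omega))⟩

/-- A `(k + 1)`-fold primitive of `G` with `k + 1` zeros in an interval of length `b - a`. By Rolle's
theorem each of its derivatives up to order `k` has a zero, and integrating back from these zeros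
gives a bound which involves neither the position of the zeros nor any constant growing with `k`. -/
theorem IterPrim.sq_le_of_zeros {a b : ℝ} : ∀ {k : ℕ} {w G : ℝ → ℝ}, IterPrim a b k w G →
    IntegrableOn (fun t => G t ^ 2) (Icc a b) →
    ∀ P : Fin (k + 1) → ℝ, StrictMono P → (∀ m, P m ∈ Icc a b) → (∀ m, w (P m) = 0) →
    ∀ y ∈ Icc a b, w y ^ 2 ≤ (b - a) ^ (2 * k + 1) * ∫ t in Icc a b, G t ^ 2
  | 0, w, G, h, hG, P, _, hPm, hPz, y, hy => by
    have h : IsPrim a b w G := h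
    have hi : 0 ≤ ∫ t in Icc a b, G t ^ 2 := integral_nonneg fun t => sq_nonneg _
    have key : ∀ x ∈ Icc a b, ∀ z ∈ Icc a b, x ≤ z → (w z - w x) ^ 2
        ≤ (b - a) ^ (2 * 0 + 1) * ∫ t in Icc a b, G t ^ 2 := by
      intro x hx z hz hxz
      have hsub : Icc x z ⊆ Icc a b := Icc_subset_Icc hx.1 hz.2
      rw [h.eq x hx z hz]
      refine (sq_intervalIntegral_le hxz (h.int.mono_set hsub) (hG.mono_set hsub)).trans ?_
      rw [mul_zero, zero_add, pow_one]
      refine mul_le_mul (by linarith [hx.1, hz.2]) ?_ (integral_nonneg fun t => sq_nonneg _)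
        (by linarith [hx.1, hz.2])
      exact setIntegral_mono_set hG (Eventually.of_forall fun t => sq_nonneg _) hsub.eventuallyLE
    rcases le_total (P 0) y with hc | hc
    · simpa [hPz 0] using key _ (hPm 0) y hy hc
    · simpa [hPz 0] using key y hy _ (hPm 0) hc
  | k + 1, w, G, ⟨w', h, h'⟩, hG, P, hP, hPm, hPz, y, hy => by
    have hroll : ∀ m : Fin (k + 1), ∃ c ∈ Ioo (P m.castSucc) (P m.succ), w' c = 0 := by
      intro m
      have hsub : Icc (P m.castSucc) (P m.succ) ⊆ Icc a b :=
        Icc_subset_Icc (hPm _).1 (hPm _).2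
      exact exists_hasDerivAt_eq_zero (f := w) (f' := w') (hP (Fin.castSucc_lt_succ))
        (h.continuousOn.mono hsub) (by rw [hPz, hPz]) fun x hx =>
          h.hasDerivAt h'.continuousOn ⟨(hPm _).1.trans_lt hx.1, hx.2.trans_le (hPm _).2⟩
    choose Q hQm hQz using hroll
    have hQ : StrictMono Q := by
      refine Fin.strictMono_iff_lt_succ.mpr fun i => ?_
      exact (hQm i.castSucc).2.trans (by
        have := (hQm i.succ).1
        rwa [← Fin.succ_castSucc] at this)
    have hb := h'.sq_le_of_zeros hG Q hQ (fun m => ⟨(hPm _).1.trans (hQm m).1.le,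
      (hQm m).2.le.trans (hPm _).2⟩) hQz
    have hab : 0 ≤ b - a := by linarith [hy.1, hy.2]
    have e : w y = ∫ t in P 0..y, w' t := by
      rw [← h.eq (P 0) (hPm 0) y hy, hPz 0, sub_zero]
    set K := (b - a) ^ (2 * k + 1) * ∫ t in Icc a b, G t ^ 2 with hK
    have hn : ‖∫ t in P 0..y, w' t‖ ≤ √K * |y - P 0| := by
      refine intervalIntegral.norm_integral_le_of_norm_le_const fun t ht => ?_
      exact Real.abs_le_sqrt (hb t (uIcc_subset_Icc (hPm 0) hy (uIoc_subset_uIcc ht)))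
    have hl : |y - P 0| ≤ b - a := abs_sub_le_iff.mpr
      ⟨by linarith [hy.2, (hPm 0).1], by linarith [hy.1, (hPm 0).2]⟩
    have hK0 : 0 ≤ K := mul_nonneg (pow_nonneg hab _) (integral_nonneg fun t => sq_nonneg _)
    rw [e, ← sq_abs]
    calc |∫ t in P 0..y, w' t| ^ 2 ≤ (√K * (b - a)) ^ 2 := by
          refine pow_le_pow_left₀ (abs_nonneg _) (hn.trans ?_) 2
          exact mul_le_mul_of_nonneg_left hl (Real.sqrt_nonneg _)
      _ = (b - a) ^ (2 * (k + 1) + 1) * ∫ t in Icc a b, G t ^ 2 := by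
          rw [mul_pow, Real.sq_sqrt hK0, hK]
          ring

/-! ### Meshes -/

namespace Mesh

variable (𝒯 : Mesh)

/-- The left end point of an element. -/
def lo (e : Fin 𝒯.nt) : ℝ := 𝒯.x e.castSucc

/-- The right end point of an element. -/
def hi (e : Fin 𝒯.nt) : ℝ := 𝒯.x e.succ

theorem lo_lt_hi (e : Fin 𝒯.nt) : 𝒯.lo e < 𝒯.hi e := 𝒯.strictMono Fin.castSucc_lt_succ

theorem x_mem (i : Fin (𝒯.nt + 1)) : 𝒯.x i ∈ Icc (0 : ℝ) 1 := by
  constructor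
  · rw [← 𝒯.first]; exact 𝒯.strictMono.monotone (Fin.zero_le i)
  · rw [← 𝒯.last]; exact 𝒯.strictMono.monotone (Fin.le_last i)

theorem lo_nonneg (e : Fin 𝒯.nt) : 0 ≤ 𝒯.lo e := (𝒯.x_mem _).1

theorem hi_le_one (e : Fin 𝒯.nt) : 𝒯.hi e ≤ 1 := (𝒯.x_mem _).2

theorem Icc_subset (e : Fin 𝒯.nt) : Icc (𝒯.lo e) (𝒯.hi e) ⊆ Icc (0 : ℝ) 1 :=
  Icc_subset_Icc (𝒯.lo_nonneg e) (𝒯.hi_le_one e)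

theorem sub_le_h (e : Fin 𝒯.nt) : 𝒯.hi e - 𝒯.lo e ≤ 𝒯.h :=
  le_ciSup (f := fun e : Fin 𝒯.nt => 𝒯.x e.succ - 𝒯.x e.castSucc)
    (Set.finite_range _).bddAbove e

theorem h_nonneg : 0 ≤ 𝒯.h := Real.iSup_nonneg fun e => sub_nonneg.mpr (𝒯.lo_lt_hi e).le

theorem exists_mem_Ico {y : ℝ} (hy : y ∈ Ico (0 : ℝ) 1) :
    ∃ e, y ∈ Ico (𝒯.lo e) (𝒯.hi e) := by
  by_contra! hne
  have : ∀ i : Fin (𝒯.nt + 1), 𝒯.x i ≤ y := by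
    intro i
    induction i using Fin.induction with
    | zero => rw [𝒯.first]; exact hy.1
    | succ i ih =>
      by_contra! hlt
      exact hne i ⟨ih, hlt⟩
  have h1 := this (Fin.last _)
  rw [𝒯.last] at h1
  exact absurd hy.2 (not_lt.mpr h1)

theorem eq_of_mem_Ico {y : ℝ} {e e' : Fin 𝒯.nt} (h : y ∈ Ico (𝒯.lo e) (𝒯.hi e))
    (h' : y ∈ Ico (𝒯.lo e') (𝒯.hi e')) : e = e' := by
  have key : ∀ {e e' : Fin 𝒯.nt}, 𝒯.lo e < 𝒯.hi e' → e ≤ e' := by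
    intro e e' hlt
    have : e.castSucc < e'.succ := 𝒯.strictMono.lt_iff_lt.mp hlt
    exact Fin.castSucc_lt_succ_iff.mp this
  exact le_antisymm (key (h.1.trans_lt h'.2)) (key (h'.1.trans_lt h.2))

theorem iUnion_Ico : ⋃ e, Ico (𝒯.lo e) (𝒯.hi e) = Ico (0 : ℝ) 1 := by
  ext y
  rw [mem_iUnion]
  refine ⟨fun ⟨e, he⟩ => ⟨(𝒯.lo_nonneg e).trans he.1, he.2.trans_le (𝒯.hi_le_one e)⟩,
    fun hy => 𝒯.exists_mem_Ico hy⟩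

theorem integral_eq_sum {F : ℝ → ℝ} (hF : IntegrableOn F (Icc 0 1)) :
    ∫ y in Ioo (0 : ℝ) 1, F y = ∑ e, ∫ y in Icc (𝒯.lo e) (𝒯.hi e), F y := by
  rw [← integral_Ico_eq_integral_Ioo, ← 𝒯.iUnion_Ico, integral_iUnion_fintype]
  · exact Finset.sum_congr rfl fun e _ => integral_Icc_eq_integral_Ico.symm
  · exact fun e => measurableSet_Ico
  · intro e e' hne
    exact Set.disjoint_left.mpr fun y hy hy' => hne (𝒯.eq_of_mem_Ico hy hy')
  · exact fun e => hF.mono_set (Ico_subset_Icc_self.trans (𝒯.Icc_subset e))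

/-- An elementwise pointwise bound by a local `L₂` norm gives a global `L₂` bound; integration over
the elements gains another factor `h`. -/
theorem norm_sq_le {u G : L2} {F : ℝ → ℝ} (hu : u =ᵐ[volume.restrict (Ioo (0 : ℝ) 1)] F) {c : ℝ}
    (hc : 0 ≤ c) (hF : ∀ e, ∀ y ∈ Icc (𝒯.lo e) (𝒯.hi e),
      F y ^ 2 ≤ c * ∫ t in Icc (𝒯.lo e) (𝒯.hi e), (G : ℝ → ℝ) t ^ 2) :
    ‖u‖ ^ 2 ≤ 𝒯.h * c * ‖G‖ ^ 2 := by
  rw [L2.norm_sq_eq, L2.norm_sq_eq, 𝒯.integral_eq_sum u.integrableOn_sq,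
    𝒯.integral_eq_sum G.integrableOn_sq, Finset.mul_sum]
  refine Finset.sum_le_sum fun e _ => ?_
  set I := ∫ t in Icc (𝒯.lo e) (𝒯.hi e), (G : ℝ → ℝ) t ^ 2
  have hI : 0 ≤ I := integral_nonneg fun t => sq_nonneg _
  have huI : u =ᵐ[volume.restrict (Icc (𝒯.lo e) (𝒯.hi e))] F := by
    have hu' : ∀ᵐ y ∂(volume.restrict (Icc (0 : ℝ) 1)), (u : ℝ → ℝ) y = F y := by
      rw [Measure.restrict_congr_set Ioo_ae_eq_Icc.symm]
      exact hu
    exact ae_restrict_of_ae_restrict_of_subset (𝒯.Icc_subset e) hu'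
  calc ∫ y in Icc (𝒯.lo e) (𝒯.hi e), (u : ℝ → ℝ) y ^ 2
      ≤ ∫ _ in Icc (𝒯.lo e) (𝒯.hi e), c * I := by
        refine integral_mono_ae (u.integrableOn_sq.mono_set (𝒯.Icc_subset e))
          (integrableOn_const (by simp)) ?_
        filter_upwards [huI, ae_restrict_mem measurableSet_Icc] with y hy hym
        rw [hy]
        exact hF e y hym
    _ = (𝒯.hi e - 𝒯.lo e) * (c * I) := by
        simp [Real.volume_real_Icc_of_le (𝒯.lo_lt_hi e).le]
    _ ≤ 𝒯.h * (c * I) := mul_le_mul_of_nonneg_right (𝒯.sub_le_h e) (mul_nonneg hc hI)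
    _ = 𝒯.h * c * I := by ring

/-! ### Discontinuous piecewise polynomials -/

/-- The piecewise polynomial function with the polynomial `p e` on the element `e`. -/
def pw (p : Fin 𝒯.nt → ℝ[X]) (y : ℝ) : ℝ :=
  ∑ e, (Ico (𝒯.lo e) (𝒯.hi e)).indicator (fun y => (p e).eval y) y

theorem pw_eq (p : Fin 𝒯.nt → ℝ[X]) {e : Fin 𝒯.nt} {y : ℝ} (hy : y ∈ Ico (𝒯.lo e) (𝒯.hi e)) :
    𝒯.pw p y = (p e).eval y := by
  rw [pw, Finset.sum_eq_single e]
  · exact indicator_of_mem hy _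
  · intro e' _ hne
    exact indicator_of_notMem (fun hy' => hne (𝒯.eq_of_mem_Ico hy' hy)) _
  · exact fun h => absurd (Finset.mem_univ e) h

theorem memLp_pw (p : Fin 𝒯.nt → ℝ[X]) : MemLp (𝒯.pw p) 2 (volume.restrict (Ioo (0 : ℝ) 1)) := by
  refine memLp_finsetSum _ fun e _ => MemLp.indicator measurableSet_Ico ?_
  obtain ⟨K, hK⟩ := isCompact_Icc.exists_bound_of_continuousOn
    (f := fun y => (p e).eval y) (s := Icc (0 : ℝ) 1) (p e).continuous.continuousOn
  refine MemLp.of_bound (p e).continuous.aestronglyMeasurable K ?_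
  filter_upwards [ae_restrict_mem measurableSet_Ioo] with y hy
  exact hK y (Ioo_subset_Icc_self hy)

theorem integrableOn_pw (p : Fin 𝒯.nt → ℝ[X]) : IntegrableOn (𝒯.pw p) (Icc (0 : ℝ) 1) := by
  rw [integrableOn_Icc_iff_integrableOn_Ioo]
  exact (𝒯.memLp_pw p).integrable (by norm_num)

theorem natDegree_le_of_degree_lt {p : ℝ[X]} {m : ℕ} (hp : p.degree < ((m + 1 : ℕ) : WithBot ℕ)) :
    p.natDegree ≤ m :=
  Polynomial.natDegree_le_iff_coeff_eq_zero.mpr fun n hn =>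
    Polynomial.coeff_eq_zero_of_degree_lt (hp.trans_le (by exact_mod_cast hn))

/-- Piecewise polynomials of degree at most `m`, as a linear image of their coefficient space. -/
def pwMap (m : ℕ) : (Fin 𝒯.nt → Polynomial.degreeLT ℝ (m + 1)) →ₗ[ℝ] L2 where
  toFun p := (𝒯.memLp_pw fun e => (p e : ℝ[X])).toLp
  map_add' p q := by
    rw [← MemLp.toLp_add]
    apply MemLp.toLp_congr
    refine Eventually.of_forall fun y => ?_
    simp only [pw, Pi.add_apply, Submodule.coe_add, Polynomial.eval_add, ← Finset.sum_add_distrib]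
    exact Finset.sum_congr rfl fun e _ => by
      simp only [indicator]
      split_ifs <;> simp
  map_smul' c p := by
    rw [RingHom.id_apply, ← MemLp.toLp_const_smul]
    apply MemLp.toLp_congr
    refine Eventually.of_forall fun y => ?_
    simp only [pw, Pi.smul_apply, Submodule.coe_smul, Polynomial.eval_smul, Finset.smul_sum]
    exact Finset.sum_congr rfl fun e _ => by rw [← indicator_const_smul_apply]

/-- The space of (discontinuous) piecewise polynomials of degree at most `m`. -/
def Dpoly (m : ℕ) : Submodule ℝ L2 := LinearMap.range (𝒯.pwMap m)

instance (m : ℕ) : FiniteDimensional ℝ (𝒯.Dpoly m) := by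
  have : Module.Finite ℝ (Polynomial.degreeLT ℝ (m + 1)) :=
    Module.Finite.equiv (Polynomial.degreeLTEquiv ℝ (m + 1)).symm
  unfold Dpoly
  infer_instance

theorem mem_Dpoly {m : ℕ} {q : L2} : q ∈ 𝒯.Dpoly m ↔ ∃ p : Fin 𝒯.nt → ℝ[X],
    (∀ e, (p e).natDegree ≤ m) ∧ q =ᵐ[volume.restrict (Ioo (0 : ℝ) 1)] 𝒯.pw p := by
  constructor
  · rintro ⟨p, rfl⟩
    refine ⟨fun e => (p e : ℝ[X]), fun e => ?_,
      (𝒯.memLp_pw fun e => (p e : ℝ[X])).coeFn_toLp⟩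
    exact natDegree_le_of_degree_lt (Polynomial.mem_degreeLT.mp (p e).2)
  · rintro ⟨p, hp, hq⟩
    refine ⟨fun e => ⟨p e, Polynomial.mem_degreeLT.mpr ?_⟩, ?_⟩
    · exact lt_of_le_of_lt (Polynomial.natDegree_le_iff_degree_le.mp (hp e))
        (by exact_mod_cast Nat.lt_succ_self m)
    · exact Lp.ext ((𝒯.memLp_pw p).coeFn_toLp.trans hq.symm)

theorem toLp_pw_mem {m : ℕ} {p : Fin 𝒯.nt → ℝ[X]} (hp : ∀ e, (p e).natDegree ≤ m) :
    (𝒯.memLp_pw p).toLp ∈ 𝒯.Dpoly m := 𝒯.mem_Dpoly.mpr ⟨p, hp, MemLp.coeFn_toLp _⟩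

/-! ### Finite element functions -/

theorem IsFE.isPrim {𝒯 : Mesh} {k : ℕ} {W : ℝ → ℝ} (hW : 𝒯.IsFE k W) :
    ∃ p : Fin 𝒯.nt → ℝ[X], (∀ e, (p e).natDegree ≤ k - 1) ∧ IsPrim 0 1 W (𝒯.pw p) := by
  choose p hp hpW using hW.poly
  refine ⟨fun e => (p e).derivative, fun e => (Polynomial.natDegree_derivative_le _).trans
    (Nat.sub_le_sub_right (hp e) 1), ?_⟩
  refine IsPrim.of_hasDerivAt (Set.finite_range 𝒯.x).countable hW.cont ?_ (𝒯.integrableOn_pw _)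
  rintro y ⟨hy, hyx⟩
  obtain ⟨e, he⟩ := 𝒯.exists_mem_Ico ⟨hy.1.le, hy.2⟩
  have hlo : 𝒯.lo e < y := lt_of_le_of_ne he.1 fun h => hyx ⟨e.castSucc, h⟩
  rw [𝒯.pw_eq _ he]
  refine ((p e).hasDerivAt y).congr_of_eventuallyEq ?_
  filter_upwards [Icc_mem_nhds hlo he.2] with z hz
  exact hpW e z hz

theorem mem_S {k : ℕ} {u : L2} (hu : u ∈ 𝒯.S k) : u ∈ H01 ∧ dy u ∈ 𝒯.Dpoly (k - 1) := by
  obtain ⟨W, hW, huW⟩ := hu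
  obtain ⟨p, hp, hWp⟩ := hW.isPrim
  have hWp' := hWp.congr_ae (𝒯.memLp_pw p).coeFn_toLp.symm
  refine ⟨mem_H01_of_isPrim hWp' huW hW.left hW.right, ?_⟩
  rw [(dy_eq_of_isPrim hWp' huW).2]
  exact 𝒯.toLp_pw_mem hp

theorem IsFE.sub {𝒯 : Mesh} {k : ℕ} {W W' : ℝ → ℝ} (h : 𝒯.IsFE k W) (h' : 𝒯.IsFE k W') :
    𝒯.IsFE k (fun y => W y - W' y) := by
  refine ⟨h.cont.sub h'.cont, by simp [h.left, h'.left], by simp [h.right, h'.right], fun e => ?_⟩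
  obtain ⟨p, hp, hpW⟩ := h.poly e
  obtain ⟨p', hp', hpW'⟩ := h'.poly e
  exact ⟨p - p', Polynomial.natDegree_sub_le_of_le hp hp' |>.trans (by simp), fun y hy => by
    rw [hpW y hy, hpW' y hy, Polynomial.eval_sub]⟩

theorem IsFE.const_mul {𝒯 : Mesh} {k : ℕ} {W : ℝ → ℝ} (h : 𝒯.IsFE k W) (c : ℝ) :
    𝒯.IsFE k (fun y => c * W y) := by
  refine ⟨continuousOn_const.mul h.cont, by simp [h.left], by simp [h.right], fun e => ?_⟩
  obtain ⟨p, hp, hpW⟩ := h.poly e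
  exact ⟨Polynomial.C c * p, (Polynomial.natDegree_C_mul_le c p).trans hp, fun y hy => by
    rw [hpW y hy, Polynomial.eval_mul, Polynomial.eval_C]⟩

theorem S_sub {k : ℕ} {u u' : L2} (hu : u ∈ 𝒯.S k) (hu' : u' ∈ 𝒯.S k) : u - u' ∈ 𝒯.S k := by
  obtain ⟨W, hW, huW⟩ := hu
  obtain ⟨W', hW', huW'⟩ := hu'
  refine ⟨_, hW.sub hW', ?_⟩
  filter_upwards [huW, huW', Lp.coeFn_sub u u'] with y e1 e2 e3
  rw [e3, Pi.sub_apply, e1, e2]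

theorem S_smul {k : ℕ} {u : L2} (c : ℝ) (hu : u ∈ 𝒯.S k) : c • u ∈ 𝒯.S k := by
  obtain ⟨W, hW, huW⟩ := hu
  refine ⟨_, hW.const_mul c, ?_⟩
  filter_upwards [huW, Lp.coeFn_smul c u] with y e1 e3
  rw [e3, Pi.smul_apply, e1, smul_eq_mul]

theorem S_add {k : ℕ} {u u' : L2} (hu : u ∈ 𝒯.S k) (hu' : u' ∈ 𝒯.S k) : u + u' ∈ 𝒯.S k := by
  have := 𝒯.S_sub hu (𝒯.S_smul (-1) hu')
  simpa using this

theorem _root_.Polynomial.exists_derivative_eq (p : ℝ[X]) :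
    ∃ P : ℝ[X], P.natDegree ≤ p.natDegree + 1 ∧ P.derivative = p := by
  refine ⟨∑ i ∈ Finset.range (p.natDegree + 1),
    Polynomial.C (p.coeff i / (i + 1)) * Polynomial.X ^ (i + 1), ?_, ?_⟩
  · refine Polynomial.natDegree_sum_le_of_forall_le _ _ fun i hi => ?_
    exact (Polynomial.natDegree_C_mul_X_pow_le _ _).trans (by
      have := Finset.mem_range.mp hi; omega)
  · conv_rhs => rw [p.as_sum_range_C_mul_X_pow]
    rw [Polynomial.derivative_sum]
    refine Finset.sum_congr rfl fun i _ => ?_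
    rw [Polynomial.derivative_C_mul_X_pow, Nat.add_sub_cancel]
    congr 2
    have : (i : ℝ) + 1 ≠ 0 := by positivity
    push_cast
    field_simp

/-- A piecewise polynomial with mean value zero is the derivative of a finite element function. -/
theorem exists_mem_S_dy_eq {m : ℕ} {q : L2} (hq : q ∈ 𝒯.Dpoly m)
    (h0 : ∫ y in Ioo (0 : ℝ) 1, (q : ℝ → ℝ) y = 0) : ∃ r ∈ 𝒯.S (m + 1), dy r = q := by
  obtain ⟨p, hp, hqp⟩ := 𝒯.mem_Dpoly.mp hq
  have hw := IsPrim.of_integrable q.integrableOn_Icc 0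
  set w : ℝ → ℝ := fun y => 0 + ∫ t in (0 : ℝ)..y, (q : ℝ → ℝ) t with hwdef
  have hw0 : w 0 = 0 := by simp [hwdef]
  have hw1 : w 1 = 0 := by
    have := hw.integral_Ioo zero_le_one
    rw [h0, hw0] at this
    linarith
  obtain ⟨K, hK⟩ := isCompact_Icc.exists_bound_of_continuousOn hw.continuousOn
  have hmem : MemLp w 2 (volume.restrict (Ioo (0 : ℝ) 1)) := by
    refine MemLp.of_bound
      ((hw.continuousOn.mono Ioo_subset_Icc_self).aestronglyMeasurable measurableSet_Ioo) K ?_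
    filter_upwards [ae_restrict_mem measurableSet_Ioo] with y hy
    exact hK y (Ioo_subset_Icc_self hy)
  refine ⟨hmem.toLp, ⟨w, ⟨hw.continuousOn, hw0, hw1, fun e => ?_⟩, hmem.coeFn_toLp⟩,
    (dy_eq_of_isPrim hw hmem.coeFn_toLp).2⟩
  obtain ⟨P, hPd, hP⟩ := (p e).exists_derivative_eq
  have hlo := left_mem_Icc.mpr (𝒯.lo_lt_hi e).le
  refine ⟨Polynomial.C (w (𝒯.lo e) - P.eval (𝒯.lo e)) + P,
    (Polynomial.natDegree_add_le _ _).trans (max_le (by simp) (hPd.trans (by have := hp e; omega))),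
    fun y hy => ?_⟩
  have hwe : IsPrim (𝒯.lo e) (𝒯.hi e) w (fun t => (p e).eval t) := by
    refine (hw.mono (𝒯.lo_nonneg e) (𝒯.hi_le_one e)).congr_ae ?_
    have := ae_restrict_of_ae_restrict_of_subset (Ioo_subset_Ioo (𝒯.lo_nonneg e) (𝒯.hi_le_one e)) hqp
    filter_upwards [this, ae_restrict_mem measurableSet_Ioo] with t ht htm
    rw [ht, 𝒯.pw_eq p (Ioo_subset_Ico_self htm)]
  have hPe : IsPrim (𝒯.lo e) (𝒯.hi e) (fun t => P.eval t) (fun t => (p e).eval t) := by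
    rw [← hP]
    exact IsPrim.of_hasDerivAt countable_empty P.continuous.continuousOn
      (fun x _ => P.hasDerivAt x) (P.derivative.continuous.continuousOn.integrableOn_compact
        isCompact_Icc)
  have e1 := hwe.eq _ hlo y hy
  have e2 := hPe.eq _ hlo y hy
  simp only [Polynomial.eval_add, Polynomial.eval_C]
  linarith

/-! ### Interpolation and Ritz projection -/

/-- The error of Lagrange interpolation is of optimal order with constant one, for every polynomial
degree and every choice of the nodes. -/
theorem norm_interpolant_sub_le {k : ℕ} (P : 𝒯.Nodes k) {f : ℝ → ℝ} {u V : L2}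
    (hu : MemH (k + 1) u) (hf : ContinuousOn f (Icc 0 1))
    (huf : u =ᵐ[volume.restrict (Ioo (0 : ℝ) 1)] f) (hV : 𝒯.IsInterpolant P f V) :
    ‖V - u‖ ≤ 𝒯.h ^ (k + 1) * ‖dy^[k + 1] u‖ := by
  obtain ⟨W, hW, hWP, hVW⟩ := hV
  obtain ⟨w, hw, huw⟩ := exists_iterPrim hu
  have hwf : EqOn w f (Icc 0 1) := eqOn_Icc_of_ae_eq hw.continuousOn hf (huw.symm.trans huf)
  have hh := 𝒯.h_nonneg
  have hF : (V - u : L2) =ᵐ[volume.restrict (Ioo (0 : ℝ) 1)] fun y => W y - w y := by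
    filter_upwards [hVW, huw, Lp.coeFn_sub V u] with y e1 e2 e3
    rw [e3, Pi.sub_apply, e1, e2]
  have key := 𝒯.norm_sq_le (c := 𝒯.h ^ (2 * k + 1)) (G := dy^[k + 1] u) hF (by positivity) ?_
  · refine le_of_sq_le_sq (key.trans (le_of_eq ?_)) (by positivity)
    ring
  · intro e y hy
    obtain ⟨p, hp, hpW⟩ := hW.poly e
    have hmem : ∀ m, P.P e m ∈ Icc (𝒯.lo e) (𝒯.hi e) := fun m =>
      ⟨(P.first e).symm.le.trans ((P.strictMono e).monotone (Fin.zero_le m)),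
        ((P.strictMono e).monotone (Fin.le_last m)).trans (P.last e).le⟩
    have h1 := ((hw.mono (𝒯.lo_nonneg e) (𝒯.hi_le_one e)).sub_polynomial p hp).sq_le_of_zeros
      ((dy^[k + 1] u).integrableOn_sq.mono_set (𝒯.Icc_subset e)) (P.P e) (P.strictMono e) hmem
      (fun m => by
        rw [← hpW _ (hmem m), hWP, hwf (𝒯.Icc_subset e (hmem m)), sub_self]) y hy
    rw [hpW y hy, ← neg_sub, neg_sq]
    refine h1.trans (mul_le_mul_of_nonneg_right ?_ (integral_nonneg fun t => sq_nonneg _))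
    exact pow_le_pow_left₀ (sub_nonneg.mpr (𝒯.lo_lt_hi e).le) (𝒯.sub_le_h e) _

theorem _root_.CNGalerkin.IterPrim.exists_polynomial {a b : ℝ} (hab : a < b) {m : ℕ} {w G : ℝ → ℝ}
    (hw : IterPrim a b m w G) (hG : IntegrableOn (fun t => G t ^ 2) (Icc a b)) :
    ∃ p : ℝ[X], p.natDegree ≤ m ∧ ∀ y ∈ Icc a b,
      (w y - p.eval y) ^ 2 ≤ (b - a) ^ (2 * m + 1) * ∫ t in Icc a b, G t ^ 2 := by
  -- interpolation at equidistant nodes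
  let P : Fin (m + 1) → ℝ := fun i => a + (b - a) * (i / (m + 1))
  have hP : StrictMono P := by
    intro i j hij
    have h1 : (i : ℝ) < j := by exact_mod_cast hij
    have h2 : 0 < b - a := sub_pos.mpr hab
    simp only [P]
    gcongr
  have hPm : ∀ i, P i ∈ Icc a b := by
    intro i
    have h1 : (i : ℝ) / (m + 1) ≤ 1 := by
      rw [div_le_one (by positivity)]
      exact_mod_cast i.2.le
    have h2 : 0 ≤ (i : ℝ) / (m + 1) := by positivity
    constructor <;> simp only [P] <;> nlinarith
  have hinj : Set.InjOn P (Finset.univ : Finset (Fin (m + 1))) := hP.injective.injOn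
  let p := Lagrange.interpolate Finset.univ P (fun i => w (P i))
  have hp : p.natDegree ≤ m := by
    have := Lagrange.degree_interpolate_lt (r := fun i => w (P i)) hinj
    rw [Finset.card_univ, Fintype.card_fin] at this
    exact natDegree_le_of_degree_lt this
  refine ⟨p, hp, (hw.sub_polynomial p hp).sq_le_of_zeros hG P hP hPm fun i => ?_⟩
  rw [Lagrange.eval_interpolate_at_node (r := fun i => w (P i)) hinj (Finset.mem_univ i), sub_self]

/-- Local interpolation gives an approximation by discontinuous piecewise polynomials with constant
one, uniformly in the degree. -/
theorem exists_Dpoly_approx {m : ℕ} {g : L2} (hg : MemH (m + 1) g) :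
    ∃ q ∈ 𝒯.Dpoly m, ‖q - g‖ ≤ 𝒯.h ^ (m + 1) * ‖dy^[m + 1] g‖ := by
  obtain ⟨w, hw, hgw⟩ := exists_iterPrim hg
  have hh := 𝒯.h_nonneg
  choose p hp hpw using fun e => (hw.mono (𝒯.lo_nonneg e) (𝒯.hi_le_one e)).exists_polynomial
    (𝒯.lo_lt_hi e) ((dy^[m + 1] g).integrableOn_sq.mono_set (𝒯.Icc_subset e))
  refine ⟨_, 𝒯.toLp_pw_mem hp, ?_⟩
  set q : L2 := (𝒯.memLp_pw p).toLp with hq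
  -- mesh points, a null set, are left out: there `pw` takes the value of the element to the right
  let F : ℝ → ℝ := fun y => if y ∈ Set.range 𝒯.x then 0 else 𝒯.pw p y - w y
  have hF : (q - g : L2) =ᵐ[volume.restrict (Ioo (0 : ℝ) 1)] F := by
    have hnull : ∀ᵐ y ∂(volume.restrict (Ioo (0 : ℝ) 1)), y ∉ Set.range 𝒯.x :=
      ae_restrict_of_ae ((Set.finite_range 𝒯.x).countable.ae_notMem volume)
    filter_upwards [(𝒯.memLp_pw p).coeFn_toLp, hgw, Lp.coeFn_sub q g, hnull] with y e1 e2 e3 e4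
    simp only [F, if_neg e4]
    rw [e3, Pi.sub_apply, hq, e1, e2]
  have key := 𝒯.norm_sq_le (c := 𝒯.h ^ (2 * m + 1)) (G := dy^[m + 1] g) hF (by positivity) ?_
  · refine le_of_sq_le_sq (key.trans (le_of_eq ?_)) (by positivity)
    ring
  · intro e y hy
    have hI : 0 ≤ ∫ t in Icc (𝒯.lo e) (𝒯.hi e), (dy^[m + 1] g : ℝ → ℝ) t ^ 2 :=
      integral_nonneg fun t => sq_nonneg _
    by_cases hyx : y ∈ Set.range 𝒯.x
    · simp only [F, if_pos hyx]
      rw [zero_pow two_ne_zero]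
      positivity
    · have hy' : y ∈ Ico (𝒯.lo e) (𝒯.hi e) :=
        ⟨hy.1, lt_of_le_of_ne hy.2 fun h => hyx ⟨e.succ, h.symm⟩⟩
      simp only [F, if_neg hyx]
      rw [𝒯.pw_eq p hy', ← neg_sub, neg_sq]
      refine (hpw e y hy).trans (mul_le_mul_of_nonneg_right ?_ hI)
      exact pow_le_pow_left₀ (sub_nonneg.mpr (𝒯.lo_lt_hi e).le) (𝒯.sub_le_h e) _

/-- `r` is the Ritz (elliptic) projection of `u` onto `S_h^k`. In one space dimension the
orthogonality of the derivatives holds against all piecewise polynomials of degree `k - 1`, and not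
only against the derivatives of finite element functions. -/
def IsRitz (k : ℕ) (u r : L2) : Prop :=
  r ∈ 𝒯.S k ∧ ∀ q ∈ 𝒯.Dpoly (k - 1), inner ℝ (dy r - dy u) q = 0

variable {𝒯}

theorem one_mem_Dpoly (m : ℕ) :
    ∃ q ∈ 𝒯.Dpoly m, q =ᵐ[volume.restrict (Ioo (0 : ℝ) 1)] fun _ => (1 : ℝ) := by
  refine ⟨_, 𝒯.toLp_pw_mem (p := fun _ => 1) (by simp), ?_⟩
  filter_upwards [(𝒯.memLp_pw fun _ => 1).coeFn_toLp, ae_restrict_mem measurableSet_Ioo]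
    with y hy hym
  obtain ⟨e, he⟩ := 𝒯.exists_mem_Ico (Ioo_subset_Ico_self hym)
  rw [hy, 𝒯.pw_eq _ he, Polynomial.eval_one]

theorem exists_isRitz (m : ℕ) {u : L2} (hu : u ∈ H01) : ∃ r, 𝒯.IsRitz (m + 1) u r := by
  set q : L2 := (𝒯.Dpoly m).starProjection (dy u) with hq
  have hqm : q ∈ 𝒯.Dpoly m := Submodule.starProjection_apply_mem _ _
  have horth : ∀ z ∈ 𝒯.Dpoly m, inner ℝ (q - dy u) z = 0 := by
    intro z hz
    rw [← neg_sub, inner_neg_left, Submodule.starProjection_inner_eq_zero _ _ hz, neg_zero]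
  obtain ⟨w, hw, huw, hw0, hw1⟩ := exists_isPrim_of_mem_H01 hu
  -- constants are piecewise polynomials, so `q` inherits mean value zero from `dy u`
  have hmean : ∫ y in Ioo (0 : ℝ) 1, (q : ℝ → ℝ) y = 0 := by
    obtain ⟨z, hz, hz1⟩ := one_mem_Dpoly (𝒯 := 𝒯) m
    have h1 : ∀ g : L2, inner ℝ g z = ∫ y in Ioo (0 : ℝ) 1, (g : ℝ → ℝ) y := fun g => by
      rw [L2.inner_eq]
      exact integral_congr_ae (hz1.mono fun y hy => by simp only [hy, mul_one])
    have h2 := horth z hz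
    rw [inner_sub_left, h1, h1, hw.integral_Ioo zero_le_one, hw0, hw1] at h2
    linarith
  obtain ⟨r, hr, hrq⟩ := 𝒯.exists_mem_S_dy_eq hqm hmean
  exact ⟨r, hr, fun z hz => by rw [hrq]; exact horth z hz⟩

namespace IsRitz

variable {k : ℕ} {u r u' r' : L2}

theorem mem_H01 (h : 𝒯.IsRitz k u r) : r ∈ H01 := (𝒯.mem_S h.1).1

theorem sub (h : 𝒯.IsRitz k u r) (h' : 𝒯.IsRitz k u' r') (hu : u ∈ H01) (hu' : u' ∈ H01) :
    𝒯.IsRitz k (u - u') (r - r') := by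
  refine ⟨𝒯.S_sub h.1 h'.1, fun q hq => ?_⟩
  rw [dy_sub h.mem_H01 h'.mem_H01, dy_sub hu hu', sub_sub_sub_comm, inner_sub_left, h.2 q hq,
    h'.2 q hq, sub_zero]

/-- The derivative of the Ritz projection is a best approximation. -/
theorem norm_dy_sub_le (h : 𝒯.IsRitz k u r) {q : L2} (hq : q ∈ 𝒯.Dpoly (k - 1)) :
    ‖dy r - dy u‖ ≤ ‖q - dy u‖ := by
  have h1 : inner ℝ (dy r - dy u) (dy r - q) = 0 :=
    h.2 _ (Submodule.sub_mem _ (𝒯.mem_S h.1).2 hq)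
  have h2 : ‖dy r - dy u‖ ^ 2 ≤ ‖dy r - dy u‖ * ‖q - dy u‖ := by
    rw [← real_inner_self_eq_norm_sq]
    have : dy r - dy u = (dy r - q) + (q - dy u) := by abel
    nth_rw 2 [this]
    rw [inner_add_right, h1, zero_add]
    exact real_inner_le_norm _ _
  rcases (norm_nonneg (dy r - dy u)).eq_or_lt with h0 | h0
  · rw [← h0]; exact norm_nonneg _
  · rw [sq] at h2
    exact le_of_mul_le_mul_left h2 h0

/-- The Ritz projection interpolates at the points of the mesh; integrating its error from there
gains a power of `h` without a duality argument. -/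
theorem norm_sub_le (h : 𝒯.IsRitz k u r) (hu : u ∈ H01) : ‖r - u‖ ≤ 𝒯.h * ‖dy r - dy u‖ := by
  have hρ := H01_sub h.mem_H01 hu
  obtain ⟨F, hF, hρF, hF0, -⟩ := exists_isPrim_of_mem_H01 hρ
  rw [dy_sub h.mem_H01 hu] at hF
  -- orthogonality to the characteristic functions of the elements
  have hstep : ∀ e, F (𝒯.hi e) - F (𝒯.lo e) = 0 := by
    intro e
    have h1 := h.2 _ (𝒯.toLp_pw_mem (m := k - 1) (p := Pi.single e 1) fun e' => by
      by_cases he : e' = e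
      · subst he; simp
      · simp [he])
    rw [L2.inner_eq] at h1
    have hle := (𝒯.lo_lt_hi e).le
    rw [hF.eq _ (𝒯.Icc_subset e ⟨le_rfl, hle⟩) _ (𝒯.Icc_subset e ⟨hle, le_rfl⟩),
      intervalIntegral.integral_of_le hle, integral_Ioc_eq_integral_Ioo,
      ← integral_Ico_eq_integral_Ioo, ← integral_indicator measurableSet_Ico]
    refine Eq.trans ?_ h1
    rw [← integral_indicator measurableSet_Ioo]
    refine integral_congr_ae ?_
    have hae := (𝒯.memLp_pw (Pi.single e 1)).coeFn_toLp
    rw [EventuallyEq, ae_restrict_iff' measurableSet_Ioo] at hae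
    filter_upwards [hae, (measure_eq_zero_iff_ae_notMem.mp (Real.volume_singleton (a := 0)))]
      with y hy hy0
    by_cases hm : y ∈ Ioo (0 : ℝ) 1
    · rw [indicator_of_mem hm, hy hm]
      obtain ⟨e', he'⟩ := 𝒯.exists_mem_Ico (Ioo_subset_Ico_self hm)
      rw [𝒯.pw_eq _ he']
      by_cases hee : e' = e
      · subst hee
        rw [indicator_of_mem he', Pi.single_eq_same, Polynomial.eval_one, mul_one]
      · rw [indicator_of_notMem (fun hh => hee (𝒯.eq_of_mem_Ico he' hh)), Pi.single_eq_of_ne hee,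
          Polynomial.eval_zero, mul_zero]
    · rw [indicator_of_notMem hm, indicator_of_notMem]
      intro hh
      refine hm ⟨lt_of_le_of_ne ((𝒯.lo_nonneg e).trans hh.1) fun h => hy0 ?_,
        hh.2.trans_le (𝒯.hi_le_one e)⟩
      exact h.symm
  have hzero : ∀ i, F (𝒯.x i) = 0 := by
    intro i
    induction i using Fin.induction with
    | zero => rw [𝒯.first, hF0]
    | succ i ih =>
      have := hstep i
      simp only [hi, lo, ih, sub_zero] at this
      exact this
  have hh := 𝒯.h_nonneg
  have key := 𝒯.norm_sq_le (c := 𝒯.h) (G := dy r - dy u) hρF hh ?_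
  · refine le_of_sq_le_sq (key.trans (le_of_eq ?_)) (by positivity)
    ring
  · intro e y hy
    have hle := (𝒯.lo_lt_hi e).le
    have hsub : Icc (𝒯.lo e) y ⊆ Icc (0 : ℝ) 1 :=
      (Icc_subset_Icc le_rfl hy.2).trans (𝒯.Icc_subset e)
    have e1 := hF.eq _ (𝒯.Icc_subset e ⟨le_rfl, hle⟩) y (𝒯.Icc_subset e hy)
    have e2 : F (𝒯.lo e) = 0 := hzero _
    rw [e2, sub_zero] at e1
    rw [e1]
    refine (sq_intervalIntegral_le hy.1 (hF.int.mono_set hsub)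
      ((dy r - dy u).integrableOn_sq.mono_set hsub)).trans ?_
    refine mul_le_mul (by linarith [𝒯.sub_le_h e, hy.2]) ?_ (integral_nonneg fun t => sq_nonneg _) hh
    exact setIntegral_mono_set ((dy r - dy u).integrableOn_sq.mono_set (𝒯.Icc_subset e))
      (Eventually.of_forall fun t => sq_nonneg _) (Icc_subset_Icc le_rfl hy.2).eventuallyLE

theorem norm_sub_le_pow {m : ℕ} (h : 𝒯.IsRitz (m + 1) u r) (hu : u ∈ H01)
    (hum : MemH (m + 2) u) : ‖r - u‖ ≤ 𝒯.h ^ (m + 2) * ‖dy^[m + 2] u‖ := by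
  obtain ⟨g, hg, hgm⟩ := hum
  rw [Function.iterate_succ_apply, dy_eq hg]
  obtain ⟨q, hq, hqg⟩ := 𝒯.exists_Dpoly_approx hgm
  have h1 := h.norm_dy_sub_le hq
  rw [dy_eq hg] at h1
  have h2 := h.norm_sub_le hu
  rw [dy_eq hg] at h2
  calc ‖r - u‖ ≤ 𝒯.h * (𝒯.h ^ (m + 1) * ‖dy^[m + 1] g‖) :=
        h2.trans (mul_le_mul_of_nonneg_left (h1.trans hqg) 𝒯.h_nonneg)
    _ = _ := by ring

end IsRitz

end Mesh

/-! ### Taylor expansion in time -/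

section Taylor

variable {E : Type*} [NormedAddCommGroup E] [NormedSpace ℝ E] {T : ℝ} {z : ℝ → E} {K : NNReal}

/-- A function whose derivative is `O(|r - t|^n)` on an interval around `t` changes by
`O(|s - t|^(n + 1))`. -/
theorem norm_sub_le_of_deriv_le {f f' : ℝ → E} {C : ℝ} (hC : 0 ≤ C) (n : ℕ) {s t : ℝ}
    (hs : s ∈ Icc 0 T) (ht : t ∈ Icc 0 T)
    (hf : ∀ r ∈ Icc 0 T, HasDerivWithinAt f (f' r) (Icc 0 T) r)
    (hb : ∀ r ∈ Icc 0 T, ‖f' r‖ ≤ C * |r - t| ^ n) :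
    ‖f s - f t‖ ≤ C * |s - t| ^ (n + 1) := by
  have hsub : uIcc t s ⊆ Icc 0 T := uIcc_subset_Icc ht hs
  have := Convex.norm_image_sub_le_of_norm_hasDerivWithin_le (f := f) (f' := f')
    (C := C * |s - t| ^ n) (s := uIcc t s)
    (fun r hr => (hf r (hsub hr)).mono hsub) (fun r hr => (hb r (hsub hr)).trans ?_)
    (convex_uIcc t s) left_mem_uIcc right_mem_uIcc
  · refine this.trans (le_of_eq ?_)
    rw [Real.norm_eq_abs]
    ring
  · gcongr C * ?_ ^ n
    exact abs_sub_left_of_mem_uIcc hr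

theorem taylor_one (hz : DifferentiableOn ℝ z (Icc 0 T))
    (hL : LipschitzOnWith K (derivWithin z (Icc 0 T)) (Icc 0 T)) {s t : ℝ}
    (hs : s ∈ Icc 0 T) (ht : t ∈ Icc 0 T) :
    ‖z s - z t - (s - t) • derivWithin z (Icc 0 T) t‖ ≤ K * |s - t| ^ 2 := by
  have key := norm_sub_le_of_deriv_le (T := T)
    (f := fun r => z r - (r - t) • derivWithin z (Icc 0 T) t)
    (f' := fun r => derivWithin z (Icc 0 T) r - derivWithin z (Icc 0 T) t) K.2 1 hs ht ?_ ?_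
  · simpa [sub_right_comm] using key
  · intro r hr
    have h1 := (hz r hr).hasDerivWithinAt
    have h2 := (((hasDerivAt_id r).sub_const t).smul_const
      (derivWithin z (Icc 0 T) t)).hasDerivWithinAt (s := Icc 0 T)
    simpa using h1.fun_sub h2
  · intro r hr
    rw [pow_one]
    simpa [dist_eq_norm] using hL.dist_le_mul r hr t ht

theorem taylor_two (hT : 0 < T) (hz : ContDiffOn ℝ 2 z (Icc 0 T))
    (hL : LipschitzOnWith K (derivWithin (derivWithin z (Icc 0 T)) (Icc 0 T)) (Icc 0 T)) {s t : ℝ}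
    (hs : s ∈ Icc 0 T) (ht : t ∈ Icc 0 T) :
    ‖z s - z t - (s - t) • derivWithin z (Icc 0 T) t
      - ((s - t) ^ 2 / 2) • derivWithin (derivWithin z (Icc 0 T)) (Icc 0 T) t‖
      ≤ K * |s - t| ^ 3 := by
  set z' := derivWithin z (Icc 0 T) with hz'
  set z'' := derivWithin z' (Icc 0 T) with hz''
  have hd' : ContDiffOn ℝ 1 z' (Icc 0 T) :=
    hz.derivWithin (uniqueDiffOn_Icc hT) (by norm_num)
  have key := norm_sub_le_of_deriv_le (T := T)
    (f := fun r => z r - (r - t) • z' t - ((r - t) ^ 2 / 2) • z'' t)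
    (f' := fun r => z' r - z' t - (r - t) • z'' t) K.2 2 hs ht ?_ ?_
  · simpa [sub_right_comm] using key
  · intro r hr
    have h1 := (hz.differentiableOn (by norm_num) r hr).hasDerivWithinAt
    have h2 := (((hasDerivAt_id r).sub_const t).smul_const (z' t)).hasDerivWithinAt (s := Icc 0 T)
    have h3 := (((((hasDerivAt_id r).sub_const t).pow 2).div_const 2).smul_const
      (z'' t)).hasDerivWithinAt (s := Icc 0 T)
    have e : ((2 : ℕ) : ℝ) * (id r - t) ^ (2 - 1) * 1 / 2 = r - t := by
      simp
    rw [e] at h3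
    simpa using (h1.fun_sub h2).fun_sub h3
  · intro r hr
    exact taylor_one (hd'.differentiableOn (by norm_num)) hL hr ht

theorem norm_centered_difference_le (hT : 0 < T) (hz : ContDiffOn ℝ 2 z (Icc 0 T))
    (hL : LipschitzOnWith K (derivWithin (derivWithin z (Icc 0 T)) (Icc 0 T)) (Icc 0 T))
    {t δ : ℝ} (hδ : 0 < δ) (h0 : 0 ≤ t - δ / 2) (h1 : t + δ / 2 ≤ T) :
    ‖derivWithin z (Icc 0 T) t - δ⁻¹ • (z (t + δ / 2) - z (t - δ / 2))‖ ≤ K * δ ^ 2 := by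
  have ht : t ∈ Icc 0 T := ⟨by linarith, by linarith⟩
  have hp := taylor_two hT hz hL (s := t + δ / 2) ⟨by linarith, h1⟩ ht
  have hm := taylor_two hT hz hL (s := t - δ / 2) ⟨h0, by linarith⟩ ht
  set z' := derivWithin z (Icc 0 T) t
  set z'' := derivWithin (derivWithin z (Icc 0 T)) (Icc 0 T) t
  have e1 : t + δ / 2 - t = δ / 2 := by ring
  have e2 : t - δ / 2 - t = -(δ / 2) := by ring
  rw [e1, abs_of_pos (by positivity)] at hp
  rw [e2, abs_neg, abs_of_pos (by positivity)] at hm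
  set P := z (t + δ / 2) - z t - (δ / 2) • z' - ((δ / 2) ^ 2 / 2) • z''
  set Q := z (t - δ / 2) - z t - (-(δ / 2)) • z' - ((-(δ / 2)) ^ 2 / 2) • z''
  have e : z' - δ⁻¹ • (z (t + δ / 2) - z (t - δ / 2)) = δ⁻¹ • (Q - P) := by
    have h3 : δ⁻¹ • (Q - P) = δ⁻¹ • (δ • z') - δ⁻¹ • (z (t + δ / 2) - z (t - δ / 2)) := by
      rw [← smul_sub]
      congr 1
      simp only [P, Q, neg_sq]
      module
    rw [h3, smul_smul, inv_mul_cancel₀ hδ.ne', one_smul]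
  rw [e, norm_smul, norm_inv, Real.norm_of_nonneg hδ.le]
  have hK : (0 : ℝ) ≤ K := K.2
  calc δ⁻¹ * ‖Q - P‖ ≤ δ⁻¹ * (K * (δ / 2) ^ 3 + K * (δ / 2) ^ 3) := by
        gcongr
        exact (norm_sub_le _ _).trans (add_le_add hm hp)
    _ = K * δ ^ 2 / 4 := by field_simp; ring
    _ ≤ K * δ ^ 2 := by nlinarith [mul_nonneg hK (sq_nonneg δ)]

theorem norm_average_sub_le (hz : DifferentiableOn ℝ z (Icc 0 T))
    (hL : LipschitzOnWith K (derivWithin z (Icc 0 T)) (Icc 0 T))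
    {t δ : ℝ} (hδ : 0 < δ) (h0 : 0 ≤ t - δ / 2) (h1 : t + δ / 2 ≤ T) :
    ‖(1 / 2 : ℝ) • (z (t + δ / 2) + z (t - δ / 2)) - z t‖ ≤ K * δ ^ 2 := by
  have ht : t ∈ Icc 0 T := ⟨by linarith, by linarith⟩
  have hp := taylor_one hz hL (s := t + δ / 2) ⟨by linarith, h1⟩ ht
  have hm := taylor_one hz hL (s := t - δ / 2) ⟨h0, by linarith⟩ ht
  set z' := derivWithin z (Icc 0 T) t
  have e1 : t + δ / 2 - t = δ / 2 := by ring
  have e2 : t - δ / 2 - t = -(δ / 2) := by ring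
  rw [e1, abs_of_pos (by positivity)] at hp
  rw [e2, abs_neg, abs_of_pos (by positivity)] at hm
  set P := z (t + δ / 2) - z t - (δ / 2) • z'
  set Q := z (t - δ / 2) - z t - (-(δ / 2)) • z'
  have e : (1 / 2 : ℝ) • (z (t + δ / 2) + z (t - δ / 2)) - z t = (1 / 2 : ℝ) • (P + Q) := by
    simp only [P, Q]
    module
  rw [e, norm_smul, Real.norm_of_nonneg (by norm_num)]
  have hK : (0 : ℝ) ≤ K := K.2
  have := norm_add_le P Q
  nlinarith [mul_nonneg hK (sq_nonneg δ)]

theorem norm_extrapolation_sub_le (hz : DifferentiableOn ℝ z (Icc 0 T))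
    (hL : LipschitzOnWith K (derivWithin z (Icc 0 T)) (Icc 0 T))
    {t δ : ℝ} (hδ : 0 < δ) (h0 : 0 ≤ t - 3 * (δ / 2)) (h1 : t ≤ T) :
    ‖(3 / 2 : ℝ) • z (t - δ / 2) - (1 / 2 : ℝ) • z (t - 3 * (δ / 2)) - z t‖
      ≤ 2 * K * δ ^ 2 := by
  have ht : t ∈ Icc 0 T := ⟨by linarith, by linarith⟩
  have hp := taylor_one hz hL (s := t - δ / 2) ⟨by linarith, by linarith⟩ ht
  have hm := taylor_one hz hL (s := t - 3 * (δ / 2)) ⟨h0, by linarith⟩ ht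
  set z' := derivWithin z (Icc 0 T) t
  have e1 : t - δ / 2 - t = -(δ / 2) := by ring
  have e2 : t - 3 * (δ / 2) - t = -(3 * (δ / 2)) := by ring
  rw [e1, abs_neg, abs_of_pos (by positivity)] at hp
  rw [e2, abs_neg, abs_of_pos (by positivity)] at hm
  set P := z (t - δ / 2) - z t - (-(δ / 2)) • z'
  set Q := z (t - 3 * (δ / 2)) - z t - (-(3 * (δ / 2))) • z'
  have e : (3 / 2 : ℝ) • z (t - δ / 2) - (1 / 2 : ℝ) • z (t - 3 * (δ / 2)) - z t
      = (3 / 2 : ℝ) • P - (1 / 2 : ℝ) • Q := by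
    simp only [P, Q]
    module
  rw [e]
  have hK : (0 : ℝ) ≤ K := K.2
  have := norm_sub_le ((3 / 2 : ℝ) • P) ((1 / 2 : ℝ) • Q)
  rw [norm_smul, norm_smul, Real.norm_of_nonneg (by norm_num),
    Real.norm_of_nonneg (by norm_num)] at this
  nlinarith [mul_nonneg hK (sq_nonneg δ)]

end Taylor

/-! ### Uniform bounds for the data and the solution -/

variable {ne : ℕ} {D : Data ne} {v : Fin ne → ℝ → L2}

namespace Data

/-- Bounds for the coefficients of the transformed problem, uniform on `[0, T]`: `c` is a lower bound
for the diffusion, and `K` bounds everything else from above. -/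
structure CoeffBounds (D : Data ne) (c K : ℝ) : Prop where
  coercive : ∀ i s, ∀ t ∈ Icc 0 D.T, c ≤ D.a i s * D.b2 t
  bounded : ∀ i s, ∀ t ∈ Icc 0 D.T, |D.a i s * D.b2 t| ≤ K
  lipschitz : ∀ i s s', ∀ t ∈ Icc 0 D.T, |D.a i s * D.b2 t - D.a i s' * D.b2 t| ≤ K * dist s s'
  b1_le : ∀ t ∈ Icc 0 D.T, ∀ y ∈ Ioo (0 : ℝ) 1, |D.b1 y t| ≤ K
  ratio_nonneg : ∀ t ∈ Icc 0 D.T, 0 ≤ D.γ' t / D.γ t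
  ratio_le : ∀ t ∈ Icc 0 D.T, D.γ' t / D.γ t ≤ K
  γ_le : ∀ t ∈ Icc 0 D.T, |D.γ t| ≤ K

/-- Consistency bounds in time for the exact solution. -/
structure TimeBounds (D : Data ne) (v : Fin ne → ℝ → L2) (K : ℝ) : Prop where
  difference : ∀ i t δ, 0 < δ → 0 ≤ t - δ / 2 → t + δ / 2 ≤ D.T →
    ‖D.dt (v i) t - δ⁻¹ • (v i (t + δ / 2) - v i (t - δ / 2))‖ ≤ K * δ ^ 2
  average : ∀ i t δ, 0 < δ → 0 ≤ t - δ / 2 → t + δ / 2 ≤ D.T →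
    ‖(1 / 2 : ℝ) • (v i (t + δ / 2) + v i (t - δ / 2)) - v i t‖ ≤ K * δ ^ 2
  average_dy : ∀ i t δ, 0 < δ → 0 ≤ t - δ / 2 → t + δ / 2 ≤ D.T →
    ‖(1 / 2 : ℝ) • (dy (v i (t + δ / 2)) + dy (v i (t - δ / 2))) - dy (v i t)‖ ≤ K * δ ^ 2
  extrapolation : ∀ i t δ, 0 < δ → 0 ≤ t - 3 * (δ / 2) → t ≤ D.T →
    ‖(3 / 2 : ℝ) • v i (t - δ / 2) - (1 / 2 : ℝ) • v i (t - 3 * (δ / 2)) - v i t‖ ≤ K * δ ^ 2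
  lipschitz : ∀ i, ∀ s ∈ Icc 0 D.T, ∀ t ∈ Icc 0 D.T, ‖v i s - v i t‖ ≤ K * |s - t|
  dy_le : ∀ i, ∀ t ∈ Icc 0 D.T, ‖dy (v i t)‖ ≤ K

theorem Hypotheses.γ_pos (hD : D.Hypotheses) {t : ℝ} (ht : t ∈ Icc 0 D.T) : 0 < D.γ t := by
  obtain ⟨γ₀, γ₁, h0, h⟩ := hD.γ_bounds
  exact h0.trans (h t ht).1

theorem b1_eq (D : Data ne) (y t : ℝ) : D.b1 y t = D.α' t / D.γ t + D.γ' t / D.γ t * y := by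
  unfold b1
  ring

theorem Hypotheses.exists_coeffBounds (hD : D.Hypotheses) :
    ∃ c, 0 < c ∧ ∀ᶠ K in atTop, D.CoeffBounds c K := by
  obtain ⟨γ₀, γ₁, hγ₀, hγ⟩ := hD.γ_bounds
  obtain ⟨m, M, hm, ha⟩ := hD.a_bounds
  have h0 : (0 : ℝ) ∈ Icc 0 D.T := ⟨le_rfl, hD.T_pos.le⟩
  have hγ₁ : 0 < γ₁ := (hD.γ_pos h0).trans (hγ 0 h0).2
  have hud := uniqueDiffOn_Icc hD.T_pos
  obtain ⟨A, hA⟩ := isCompact_Icc.exists_bound_of_continuousOn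
    (hD.α_smooth.continuousOn_derivWithin hud (by norm_num))
  obtain ⟨B, hB⟩ := isCompact_Icc.exists_bound_of_continuousOn
    (hD.β_smooth.continuousOn_derivWithin hud (by norm_num))
  have hA' : ∀ t ∈ Icc 0 D.T, |D.α' t| ≤ A := hA
  have hB' : ∀ t ∈ Icc 0 D.T, |D.β' t| ≤ B := hB
  have hA0 : 0 ≤ A := (abs_nonneg _).trans (hA' 0 h0)
  have hB0 : 0 ≤ B := (abs_nonneg _).trans (hB' 0 h0)
  have hγ' : ∀ t ∈ Icc 0 D.T, |D.γ' t| ≤ A + B := fun t ht => by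
    have := abs_sub (D.β' t) (D.α' t)
    have := hA' t ht
    have := hB' t ht
    unfold γ'
    linarith
  have hdiv : ∀ t ∈ Icc 0 D.T, ∀ {x R : ℝ}, |x| ≤ R → |x / D.γ t| ≤ R / γ₀ := by
    intro t ht x R hx
    have hR : 0 ≤ R := (abs_nonneg _).trans hx
    rw [abs_div, abs_of_pos (hD.γ_pos ht)]
    exact div_le_div₀ hR hx hγ₀ (hγ t ht).1.le
  have hb2 : ∀ t ∈ Icc 0 D.T, 1 / γ₁ ^ 2 ≤ D.b2 t ∧ D.b2 t ≤ 1 / γ₀ ^ 2 := by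
    intro t ht
    have hp := hD.γ_pos ht
    unfold b2
    constructor
    · exact one_div_le_one_div_of_le (by positivity) (by gcongr; exact (hγ t ht).2.le)
    · exact one_div_le_one_div_of_le (by positivity) (by gcongr; exact (hγ t ht).1.le)
  choose L hL using hD.a_lipschitz
  refine ⟨m * (1 / γ₁ ^ 2), by positivity, ?_⟩
  have hLe : ∀ᶠ K : ℝ in atTop, ∀ i, (L i : ℝ) * (1 / γ₀ ^ 2) ≤ K :=
    eventually_all.mpr fun i => eventually_ge_atTop _
  filter_upwards [hLe, eventually_ge_atTop (M * (1 / γ₀ ^ 2)),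
    eventually_ge_atTop ((A + (A + B)) / γ₀), eventually_ge_atTop ((A + B) / γ₀),
    eventually_ge_atTop γ₁] with K h1 h2 h3 h4 h5
  constructor
  · intro i s t ht
    exact mul_le_mul (ha i s).1 (hb2 t ht).1 (by positivity) (hm.le.trans (ha i s).1)
  · intro i s t ht
    have hb0 : 0 ≤ D.b2 t := le_trans (by positivity) (hb2 t ht).1
    have ha0 : 0 ≤ D.a i s := hm.le.trans (ha i s).1
    rw [abs_of_nonneg (mul_nonneg ha0 hb0)]
    exact (mul_le_mul (ha i s).2 (hb2 t ht).2 hb0 (ha0.trans (ha i s).2)).trans h2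
  · intro i s s' t ht
    have hb0 : 0 ≤ D.b2 t := le_trans (by positivity) (hb2 t ht).1
    have h6 := (hL i).dist_le_mul s s'
    rw [Real.dist_eq] at h6
    rw [← sub_mul, abs_mul, abs_of_nonneg hb0]
    calc |D.a i s - D.a i s'| * D.b2 t ≤ (L i * dist s s') * (1 / γ₀ ^ 2) :=
          mul_le_mul h6 (hb2 t ht).2 hb0 (by positivity)
      _ = (L i * (1 / γ₀ ^ 2)) * dist s s' := by ring
      _ ≤ K * dist s s' := mul_le_mul_of_nonneg_right (h1 i) dist_nonneg
  · intro t ht y hy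
    refine (hdiv t ht (R := A + (A + B)) ?_).trans h3
    refine (abs_add_le _ _).trans (add_le_add (hA' t ht) ?_)
    rw [abs_mul, abs_of_pos hy.1]
    exact (mul_le_of_le_one_right (abs_nonneg _) hy.2.le).trans (hγ' t ht)
  · intro t ht
    refine div_nonneg ?_ (hD.γ_pos ht).le
    unfold γ'
    linarith [hD.α_deriv t ht, hD.β_deriv t ht]
  · intro t ht
    exact (le_abs_self _).trans ((hdiv t ht (hγ' t ht)).trans h4)
  · intro t ht
    rw [abs_of_pos (hD.γ_pos ht)]
    exact (hγ t ht).2.le.trans h5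

theorem Hypotheses.eventually_timeBounds (hD : D.Hypotheses) (hreg : ∀ i, D.TimeRegular (v i)) :
    ∀ᶠ K in atTop, D.TimeBounds v K := by
  have hud := uniqueDiffOn_Icc hD.T_pos
  have h1 : ∀ i, ∃ L, LipschitzOnWith L (derivWithin (v i) (Icc 0 D.T)) (Icc 0 D.T) := fun i =>
    ((hreg i).smooth.derivWithin (m := 1) hud (by norm_num)).exists_lipschitzOnWith
      (by norm_num) (convex_Icc _ _) isCompact_Icc
  have h2 : ∀ i, ∃ L, LipschitzOnWith L (v i) (Icc 0 D.T) := fun i =>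
    (hreg i).smooth.exists_lipschitzOnWith (by norm_num) (convex_Icc _ _) isCompact_Icc
  have h3 : ∀ i, ∃ B, ∀ t ∈ Icc 0 D.T, ‖dy (v i t)‖ ≤ B := fun i =>
    isCompact_Icc.exists_bound_of_continuousOn (hreg i).smooth_dy.continuousOn
  choose L1 hL1 using h1
  choose L2 hL2 using h2
  choose B hB using h3
  choose K1 hK1 using fun i => (hreg i).lipschitz
  choose K2 hK2 using fun i => (hreg i).lipschitz_dy
  have hge : ∀ f : Fin ne → ℝ, ∀ᶠ K : ℝ in atTop, ∀ i, f i ≤ K := fun f =>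
    eventually_all.mpr fun i => eventually_ge_atTop _
  filter_upwards [hge fun i => 2 * L1 i, hge fun i => L1 i, hge fun i => L2 i, hge B,
    hge fun i => K1 i, hge fun i => K2 i] with K g1 g2 g3 g4 g5 g6
  have hd : ∀ i, DifferentiableOn ℝ (v i) (Icc 0 D.T) := fun i =>
    (hreg i).smooth.differentiableOn (by norm_num)
  constructor
  · intro i t δ hδ h0 h1
    exact (norm_centered_difference_le hD.T_pos (hreg i).smooth (hK1 i) hδ h0 h1).trans
      (mul_le_mul_of_nonneg_right (g5 i) (sq_nonneg δ))
  · intro i t δ hδ h0 h1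
    exact (norm_average_sub_le (hd i) (hL1 i) hδ h0 h1).trans
      (mul_le_mul_of_nonneg_right (g2 i) (sq_nonneg δ))
  · intro i t δ hδ h0 h1
    exact (norm_average_sub_le (z := fun t => dy (v i t))
      ((hreg i).smooth_dy.differentiableOn (by norm_num)) (hK2 i) hδ h0 h1).trans
      (mul_le_mul_of_nonneg_right (g6 i) (sq_nonneg δ))
  · intro i t δ hδ h0 h1
    exact (norm_extrapolation_sub_le (hd i) (hL1 i) hδ h0 h1).trans
      (mul_le_mul_of_nonneg_right (g1 i) (sq_nonneg δ))
  · intro i s hs t ht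
    rw [← dist_eq_norm, ← Real.dist_eq]
    exact ((hL2 i).dist_le_mul s hs t ht).trans (mul_le_mul_of_nonneg_right (g3 i) dist_nonneg)
  · exact fun i t ht => (hB i t ht).trans (g4 i)

end Data

/-! ### The convection form -/

namespace Data

/-- The convection form `∫₀¹ b₁(y, t) p w dy`, as a bilinear form in `p, w ∈ L₂(Ω)`. -/
def convForm (D : Data ne) (t : ℝ) (p w : L2) : ℝ := ∫ y in Ioo (0 : ℝ) 1, D.b1 y t * p y * w y

theorem conv_eq (t : ℝ) (u w : L2) : D.conv t u w = D.convForm t (dy u) w := rfl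

theorem integrable_convForm (t : ℝ) (p w : L2) :
    IntegrableOn (fun y => D.b1 y t * p y * w y) (Ioo 0 1) := by
  have hc : Continuous fun y => D.b1 y t := by
    unfold b1
    fun_prop
  obtain ⟨B, hB⟩ := isCompact_Icc.exists_bound_of_continuousOn (s := Icc (0 : ℝ) 1) hc.continuousOn
  have h : IntegrableOn (fun y => D.b1 y t * (p y * w y)) (Ioo 0 1) := by
    refine Integrable.bdd_mul (c := B) (L2.integrableOn_mul p w) hc.aestronglyMeasurable ?_
    filter_upwards [ae_restrict_mem measurableSet_Ioo] with y hy
    exact hB y (Ioo_subset_Icc_self hy)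
  simpa only [mul_assoc] using h

theorem convForm_add (t : ℝ) (p q w : L2) :
    D.convForm t (p + q) w = D.convForm t p w + D.convForm t q w := by
  unfold convForm
  rw [← integral_add (integrable_convForm t p w) (integrable_convForm t q w)]
  refine integral_congr_ae ?_
  filter_upwards [Lp.coeFn_add p q] with y hy
  rw [hy, Pi.add_apply]
  ring

theorem convForm_sub (t : ℝ) (p q w : L2) :
    D.convForm t (p - q) w = D.convForm t p w - D.convForm t q w := by
  have := convForm_add (D := D) t (p - q) q w
  rw [sub_add_cancel] at this
  linarith

theorem CoeffBounds.abs_convForm_le {c K : ℝ} (hb : D.CoeffBounds c K) {t : ℝ}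
    (ht : t ∈ Icc 0 D.T) (p w : L2) : |D.convForm t p w| ≤ K * (‖p‖ * ‖w‖) := by
  have hK : 0 ≤ K := (abs_nonneg _).trans (hb.γ_le t ht)
  have h1 : ∫ y in Ioo (0 : ℝ) 1, |(p : ℝ → ℝ) y * w y| ≤ ‖p‖ * ‖w‖ := by
    have h := real_inner_le_norm |p| |w|
    rw [norm_abs_eq_norm, norm_abs_eq_norm, L2.inner_eq] at h
    refine le_trans (le_of_eq (integral_congr_ae ?_)) h
    filter_upwards [Lp.coeFn_abs p, Lp.coeFn_abs w] with y e1 e2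
    rw [e1, e2, abs_mul]
  refine (abs_integral_le_integral_abs).trans ?_
  refine le_trans ?_ (mul_le_mul_of_nonneg_left h1 hK)
  rw [← integral_const_mul]
  refine integral_mono_ae (integrable_convForm t p w).abs
    ((L2.integrableOn_mul p w).abs.const_mul K) ?_
  filter_upwards [ae_restrict_mem measurableSet_Ioo] with y hy
  rw [mul_assoc, abs_mul]
  exact mul_le_mul_of_nonneg_right (hb.b1_le t ht y hy) (abs_nonneg _)

/-- Integration by parts in the convection form. -/
theorem convForm_dy (t : ℝ) {u w : L2} (hu : u ∈ H01) (hw : w ∈ H01) :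
    D.convForm t (dy u) w = - D.convForm t (dy w) u - D.γ' t / D.γ t * inner ℝ u w := by
  have h := integral_affine_mul hu hw (D.α' t / D.γ t) (D.γ' t / D.γ t)
  simp only [← b1_eq] at h
  unfold convForm
  linarith

/-- As the domain expands, the convection term has the favourable sign in the energy estimate. -/
theorem CoeffBounds.convForm_self_nonpos {c K : ℝ} (hb : D.CoeffBounds c K) {t : ℝ}
    (ht : t ∈ Icc 0 D.T) {w : L2} (hw : w ∈ H01) : D.convForm t (dy w) w ≤ 0 := by
  have h := convForm_dy (D := D) t hw hw
  rw [real_inner_self_eq_norm_sq] at h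
  have := mul_nonneg (hb.ratio_nonneg t ht) (sq_nonneg ‖w‖)
  linarith

/-- The convection term of a function is controlled by its `L₂` norm alone. -/
theorem CoeffBounds.abs_convForm_dy_le {c K : ℝ} (hb : D.CoeffBounds c K) {t : ℝ}
    (ht : t ∈ Icc 0 D.T) {u w : L2} (hu : u ∈ H01) (hw : w ∈ H01) :
    |D.convForm t (dy u) w| ≤ 2 * K * ‖u‖ * ‖dy w‖ := by
  have hK : 0 ≤ K := (abs_nonneg _).trans (hb.γ_le t ht)
  rw [convForm_dy t hu hw]
  have h1 := hb.abs_convForm_le ht (dy w) u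
  have h2 : |D.γ' t / D.γ t * inner ℝ u w| ≤ K * (‖u‖ * ‖dy w‖) := by
    rw [abs_mul, abs_of_nonneg (hb.ratio_nonneg t ht)]
    refine mul_le_mul (hb.ratio_le t ht) ((abs_real_inner_le_norm u w).trans ?_) (abs_nonneg _) hK
    exact mul_le_mul_of_nonneg_left (norm_le_norm_dy hw) (norm_nonneg _)
  calc |-D.convForm t (dy w) u - D.γ' t / D.γ t * inner ℝ u w|
      ≤ |D.convForm t (dy w) u| + |D.γ' t / D.γ t * inner ℝ u w| := by
        have := abs_sub (-D.convForm t (dy w) u) (D.γ' t / D.γ t * inner ℝ u w)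
        rwa [abs_neg] at this
    _ ≤ 2 * K * ‖u‖ * ‖dy w‖ := by linarith

theorem CoeffBounds.abs_l_sub_le {c K : ℝ} (hb : D.CoeffBounds c K) {t : ℝ}
    (ht : t ∈ Icc 0 D.T) (u w : L2) : |D.l t u - D.l t w| ≤ K * ‖u - w‖ := by
  have h : (∫ y in Ioo (0 : ℝ) 1, (u : ℝ → ℝ) y) - ∫ y in Ioo (0 : ℝ) 1, (w : ℝ → ℝ) y
      = ∫ y in (0 : ℝ)..1, (u - w : L2) y := by
    rw [← integral_sub u.integrableOn w.integrableOn, intervalIntegral.integral_of_le zero_le_one,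
      integral_Ioc_eq_integral_Ioo]
    refine integral_congr_ae ?_
    filter_upwards [Lp.coeFn_sub u w] with y hy
    rw [hy, Pi.sub_apply]
  have h2 := sq_intervalIntegral_le zero_le_one (u - w).integrableOn_Icc (u - w).integrableOn_sq
  rw [integral_Icc_eq_integral_Ioo, ← L2.norm_sq_eq, sub_zero, one_mul] at h2
  unfold l
  rw [← mul_sub, abs_mul, h]
  exact mul_le_mul (hb.γ_le t ht) (abs_le_of_sq_le_sq h2 (norm_nonneg _)) (abs_nonneg _)
    ((abs_nonneg _).trans (hb.γ_le t ht))

end Data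

/-! ### The energy estimate for one time step -/

/-- One Crank–Nicolson step for the distance of the discrete solution from the Ritz projection of
the exact one: the squared `L₂` norm grows at most by `δ` times the squared consistency error `E`.
The diffusion term absorbs the whole right-hand side, so that no smallness of `δ` is needed. -/
theorem energy_step {𝒯 : Mesh} {k : ℕ} {c K : ℝ} (hc : 0 < c) (hb : D.CoeffBounds c K)
    {t δ : ℝ} (hδ : 0 < δ) (ht : t ∈ Icc 0 D.T) {A A₀ E : ℝ} (hA : c ≤ A) (hAK : |A| ≤ K)
    {u u₀ u₁ u' r₀ r₁ V V' : L2} {src : L2 → ℝ} (hu₀ : u₀ ∈ H01) (hu₁ : u₁ ∈ H01)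
    (hr₀ : 𝒯.IsRitz k u₀ r₀) (hr₁ : 𝒯.IsRitz k u₁ r₁) (hV : V ∈ 𝒯.S k) (hV' : V' ∈ 𝒯.S k)
    (heq : ∀ W ∈ H01, inner ℝ u' W + A₀ * inner ℝ (dy u) (dy W) - D.conv t u W = src W)
    (hCN : ∀ W ∈ 𝒯.S k, inner ℝ (δ⁻¹ • (V' - V)) W
      + A * inner ℝ (dy ((1 / 2 : ℝ) • (V' + V))) (dy W)
      - D.conv t ((1 / 2 : ℝ) • (V' + V)) W = src W)
    (hdiff : ‖u' - δ⁻¹ • (u₁ - u₀)‖ ≤ E)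
    (havg : ‖(1 / 2 : ℝ) • (dy u₁ + dy u₀) - dy u‖ ≤ E) (hdy : ‖dy u‖ ≤ K) (hAA : |A₀ - A| ≤ E)
    (hρ₀ : ‖r₀ - u₀‖ ≤ E) (hρ₁ : ‖r₁ - u₁‖ ≤ E)
    (hρ : ‖(r₁ - u₁) - (r₀ - u₀)‖ ≤ δ * E) :
    ‖V' - r₁‖ ^ 2 ≤ ‖V - r₀‖ ^ 2 + δ * (((2 + 5 * K) * E) ^ 2 / (2 * c)) := by
  have hK : 0 ≤ K := (abs_nonneg _).trans hAK
  have hE : 0 ≤ E := (norm_nonneg _).trans hdiff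
  set θ := V - r₀ with hθ
  set θ' := V' - r₁ with hθ'
  set ρ₀ := r₀ - u₀ with hρ₀d
  set ρ₁ := r₁ - u₁ with hρ₁d
  set W := (1 / 2 : ℝ) • (θ' + θ) with hW
  set ρ := (1 / 2 : ℝ) • (ρ₁ + ρ₀) with hρd
  set p := (1 / 2 : ℝ) • (dy u₁ + dy u₀) with hp
  have hWS : W ∈ 𝒯.S k := 𝒯.S_smul _ (𝒯.S_add (𝒯.S_sub hV' hr₁.1) (𝒯.S_sub hV hr₀.1))
  obtain ⟨hWH, hWD⟩ := 𝒯.mem_S hWS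
  have hρH₀ : ρ₀ ∈ H01 := H01_sub hr₀.mem_H01 hu₀
  have hρH₁ : ρ₁ ∈ H01 := H01_sub hr₁.mem_H01 hu₁
  have hρH : ρ ∈ H01 := H01_smul _ (H01_add hρH₁ hρH₀)
  have huH : (1 / 2 : ℝ) • (u₁ + u₀) ∈ H01 := H01_smul _ (H01_add hu₁ hu₀)
  have hsplit : dy ((1 / 2 : ℝ) • (V' + V)) = dy W + dy ρ + p := by
    have e : (1 / 2 : ℝ) • (V' + V) = W + ρ + (1 / 2 : ℝ) • (u₁ + u₀) := by
      simp only [hW, hρd, hθ, hθ', hρ₀d, hρ₁d]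
      module
    rw [e, dy_add (H01_add hWH hρH) huH, dy_add hWH hρH, dy_smul _ (H01_add hu₁ hu₀),
      dy_add hu₁ hu₀]
  -- the Ritz error disappears from the diffusion term
  have horth : inner ℝ (dy ρ) (dy W) = 0 := by
    rw [hρd, dy_smul _ (H01_add hρH₁ hρH₀), dy_add hρH₁ hρH₀, hρ₀d, hρ₁d,
      dy_sub hr₀.mem_H01 hu₀, dy_sub hr₁.mem_H01 hu₁, real_inner_smul_left, inner_add_left,
      hr₀.2 _ hWD, hr₁.2 _ hWD]
    ring
  -- testing with the average turns the difference quotient of `θ` into one of `‖θ‖ ^ 2 / 2`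
  have htime : inner ℝ (δ⁻¹ • (V' - V)) W = δ⁻¹ * ((‖θ'‖ ^ 2 - ‖θ‖ ^ 2) / 2)
      + inner ℝ (δ⁻¹ • (ρ₁ - ρ₀)) W + inner ℝ (δ⁻¹ • (u₁ - u₀)) W := by
    have e : δ⁻¹ • (V' - V) = δ⁻¹ • (θ' - θ) + δ⁻¹ • (ρ₁ - ρ₀) + δ⁻¹ • (u₁ - u₀) := by
      simp only [hθ, hθ', hρ₀d, hρ₁d]
      module
    have e2 : inner ℝ (θ' - θ) W = (‖θ'‖ ^ 2 - ‖θ‖ ^ 2) / 2 := by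
      rw [hW, real_inner_smul_right, inner_sub_left, inner_add_right, inner_add_right,
        real_inner_self_eq_norm_sq, real_inner_self_eq_norm_sq, real_inner_comm θ θ']
      ring
    rw [e, inner_add_left, inner_add_left, real_inner_smul_left (θ' - θ) W δ⁻¹, e2]
  have h1 := hCN W hWS
  rw [← heq W hWH, htime, hsplit, inner_add_left, inner_add_left, horth,
    real_inner_self_eq_norm_sq, D.conv_eq, D.conv_eq, hsplit, D.convForm_add, D.convForm_add] at h1
  set x := ‖dy W‖ with hx
  have hx0 : 0 ≤ x := norm_nonneg _
  have hWx : ‖W‖ ≤ x := norm_le_norm_dy hWH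
  have b0 := hb.convForm_self_nonpos ht hWH
  have b1 : inner ℝ u' W - inner ℝ (δ⁻¹ • (u₁ - u₀)) W ≤ E * x := by
    rw [← inner_sub_left]
    exact (real_inner_le_norm _ _).trans (mul_le_mul hdiff hWx (norm_nonneg _) hE)
  have b2 : -inner ℝ (δ⁻¹ • (ρ₁ - ρ₀)) W ≤ E * x := by
    refine (neg_le_abs _).trans ((abs_real_inner_le_norm _ _).trans ?_)
    refine mul_le_mul ?_ hWx (norm_nonneg _) hE
    rw [norm_smul, norm_inv, Real.norm_of_nonneg hδ.le, inv_mul_le_iff₀ hδ]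
    exact hρ
  have b3 : (A₀ - A) * inner ℝ (dy u) (dy W) ≤ E * (K * x) := by
    refine (le_abs_self _).trans ?_
    rw [abs_mul]
    refine mul_le_mul hAA ((abs_real_inner_le_norm _ _).trans ?_) (abs_nonneg _) hE
    exact mul_le_mul_of_nonneg_right hdy hx0
  have b4 : A * (inner ℝ (dy u) (dy W) - inner ℝ p (dy W)) ≤ K * (E * x) := by
    refine (le_abs_self _).trans ?_
    rw [abs_mul, ← inner_sub_left]
    refine mul_le_mul hAK ((abs_real_inner_le_norm _ _).trans ?_) (abs_nonneg _) hK
    rw [norm_sub_rev]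
    exact mul_le_mul_of_nonneg_right havg hx0
  have b5 : D.convForm t (dy ρ) W ≤ 2 * K * E * x := by
    refine (le_abs_self _).trans ((hb.abs_convForm_dy_le ht hρH hWH).trans ?_)
    refine mul_le_mul_of_nonneg_right (mul_le_mul_of_nonneg_left ?_ (by positivity)) hx0
    rw [hρd, norm_smul, Real.norm_of_nonneg (by norm_num)]
    linarith [norm_add_le ρ₁ ρ₀]
  have b6 : D.convForm t p W - D.convForm t (dy u) W ≤ K * (E * x) := by
    rw [← D.convForm_sub]
    refine (le_abs_self _).trans ((hb.abs_convForm_le ht _ _).trans ?_)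
    exact mul_le_mul_of_nonneg_left (mul_le_mul havg hWx (norm_nonneg _) hE) hK
  have b7 : c * x ^ 2 ≤ A * x ^ 2 := mul_le_mul_of_nonneg_right hA (sq_nonneg x)
  set R := (2 + 5 * K) * E with hR
  have hsum : δ⁻¹ * ((‖θ'‖ ^ 2 - ‖θ‖ ^ 2) / 2) ≤ R * x - c * x ^ 2 := by
    rw [hR]
    linarith
  -- the diffusion `c * x ^ 2` absorbs the linear term, by completing the square
  have hmax : R * x - c * x ^ 2 ≤ R ^ 2 / (4 * c) := by
    rw [le_div_iff₀ (by positivity)]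
    nlinarith [sq_nonneg (R - 2 * c * x)]
  have h2 := mul_le_mul_of_nonneg_left (hsum.trans hmax) hδ.le
  rw [← mul_assoc, mul_inv_cancel₀ hδ.ne', one_mul] at h2
  have e : δ * (R ^ 2 / (2 * c)) = 2 * (δ * (R ^ 2 / (4 * c))) := by
    field_simp
    ring
  rw [e]
  linarith

/-! ### Error estimates for the scheme -/

variable {𝒯 : Mesh} {m : ℕ} {c K M : ℝ}
  {r : Fin ne → ℝ → L2}

theorem Data.SpaceRegular.mono {k : ℕ} {M' : ℝ} {w : ℝ → L2} (h : D.SpaceRegular k M w)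
    (hM : M ≤ M') : D.SpaceRegular k M' w :=
  ⟨h.mem, fun t ht => (h.bound t ht).trans hM, fun s hs t ht =>
    (h.lipschitz s hs t ht).trans (mul_le_mul_of_nonneg_right hM (abs_nonneg _))⟩

/-- `r i t` is the Ritz projection of `v i t` for all times `t`. -/
def RitzFamily (D : Data ne) (v : Fin ne → ℝ → L2) (𝒯 : Mesh) (k : ℕ) (r : Fin ne → ℝ → L2) :
    Prop :=
  ∀ i, ∀ t ∈ Icc 0 D.T, 𝒯.IsRitz k (v i t) (r i t)

theorem RitzFamily.norm_sub_le (hr : RitzFamily D v 𝒯 (m + 1) r) (hv : D.IsWeakSolution v)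
    (hS : ∀ i, D.SpaceRegular (m + 1) M (v i)) (i : Fin ne) {t : ℝ} (ht : t ∈ Icc 0 D.T) :
    ‖r i t - v i t‖ ≤ M * 𝒯.h ^ (m + 2) := by
  rw [mul_comm]
  refine ((hr i t ht).norm_sub_le_pow (hv.mem_H01 i t ht) ((hS i).mem t ht)).trans ?_
  exact mul_le_mul_of_nonneg_left ((norm_dy_iterate_le _ le_rfl _).trans ((hS i).bound t ht))
    (pow_nonneg 𝒯.h_nonneg _)

theorem RitzFamily.norm_sub_sub_le (hr : RitzFamily D v 𝒯 (m + 1) r) (hv : D.IsWeakSolution v)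
    (hS : ∀ i, D.SpaceRegular (m + 1) M (v i)) (i : Fin ne) {s t : ℝ} (hs : s ∈ Icc 0 D.T)
    (ht : t ∈ Icc 0 D.T) :
    ‖(r i t - v i t) - (r i s - v i s)‖ ≤ M * |t - s| * 𝒯.h ^ (m + 2) := by
  rw [mul_comm, sub_sub_sub_comm]
  have hus := hv.mem_H01 i s hs
  have hut := hv.mem_H01 i t ht
  refine (((hr i t ht).sub (hr i s hs) hut hus).norm_sub_le_pow (H01_sub hut hus)
    (((hS i).mem t ht).sub ((hS i).mem s hs))).trans ?_
  exact mul_le_mul_of_nonneg_left ((norm_dy_iterate_le _ le_rfl _).trans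
    ((hS i).lipschitz s hs t ht)) (pow_nonneg 𝒯.h_nonneg _)

/-- The energy estimate for one step of the scheme, in terms of a bound `η` for the error of the
argument of the diffusion coefficients. -/
theorem CNStep.norm_sq_le (hc : 0 < c) (hb : D.CoeffBounds c K) (htb : D.TimeBounds v K)
    (hK : 0 ≤ K) (hM : 0 ≤ M) (hv : D.IsWeakSolution v)
    (hS : ∀ i, D.SpaceRegular (m + 1) M (v i)) (hr : RitzFamily D v 𝒯 (m + 1) r)
    {t δ : ℝ} (hδ : 0 < δ) (h0 : 0 ≤ t - δ / 2) (h1 : t + δ / 2 ≤ D.T)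
    {Z V V' : Fin ne → L2} (hV : ∀ i, V i ∈ 𝒯.S (m + 1))
    (hCN : CNStep D (𝒯.S (m + 1)) δ t Z V V') {η : ℝ} (hη : ∀ j, ‖Z j - v j t‖ ≤ η) (i : Fin ne) :
    ‖V' i - r i (t + δ / 2)‖ ^ 2 ≤ ‖V i - r i (t - δ / 2)‖ ^ 2
      + δ * (((2 + 5 * K) * ((K + K ^ 2 + M) * (𝒯.h ^ (m + 2) + δ ^ 2 + η))) ^ 2 / (2 * c)) := by
  have ht : t ∈ Icc 0 D.T := ⟨by linarith, by linarith⟩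
  have ht0 : t - δ / 2 ∈ Icc 0 D.T := ⟨h0, by linarith⟩
  have ht1 : t + δ / 2 ∈ Icc 0 D.T := ⟨by linarith, h1⟩
  have hη0 : 0 ≤ η := (norm_nonneg _).trans (hη i)
  have hh : 0 ≤ 𝒯.h ^ (m + 2) := pow_nonneg 𝒯.h_nonneg _
  have hd : 0 ≤ δ ^ 2 := sq_nonneg δ
  have hE1 : K * δ ^ 2 ≤ (K + K ^ 2 + M) * (𝒯.h ^ (m + 2) + δ ^ 2 + η) :=
    mul_le_mul (by nlinarith) (by linarith) hd (by positivity)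
  have hE2 : M * 𝒯.h ^ (m + 2) ≤ (K + K ^ 2 + M) * (𝒯.h ^ (m + 2) + δ ^ 2 + η) :=
    mul_le_mul (by nlinarith) (by linarith) hh (by positivity)
  have hE3 : K ^ 2 * η ≤ (K + K ^ 2 + M) * (𝒯.h ^ (m + 2) + δ ^ 2 + η) :=
    mul_le_mul (by nlinarith) (by linarith) hη0 (by positivity)
  refine energy_step (src := D.source i t) (u := v i t) (u' := D.dt (v i) t)
    (A₀ := D.a i (fun j => D.l t (v j t)) * D.b2 t) hc hb hδ ht
    (hb.coercive i (fun j => D.l t (Z j)) t ht) (hb.bounded i _ t ht) (hv.mem_H01 i _ ht0)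
    (hv.mem_H01 i _ ht1) (hr i _ ht0) (hr i _ ht1) (hV i) (hCN.1 i)
    (hv.equation i t ⟨by linarith, by linarith⟩) (hCN.2 i)
    ((htb.difference i t δ hδ h0 h1).trans hE1) ((htb.average_dy i t δ hδ h0 h1).trans hE1)
    (htb.dy_le i t ht) ?_ ((hr.norm_sub_le hv hS i ht0).trans hE2)
    ((hr.norm_sub_le hv hS i ht1).trans hE2) ?_
  · refine ((hb.lipschitz i _ _ t ht).trans ?_).trans hE3
    rw [sq, mul_assoc]
    refine mul_le_mul_of_nonneg_left ((dist_pi_le_iff (by positivity)).mpr fun j => ?_) hK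
    rw [Real.dist_eq]
    refine (hb.abs_l_sub_le ht _ _).trans (mul_le_mul_of_nonneg_left ?_ hK)
    rw [norm_sub_rev]
    exact hη j
  · have h2 := hr.norm_sub_sub_le hv hS i ht0 ht1
    have e : |t + δ / 2 - (t - δ / 2)| = δ := by
      rw [show t + δ / 2 - (t - δ / 2) = δ by ring, abs_of_pos hδ]
    rw [e] at h2
    refine h2.trans (le_trans (le_of_eq ?_) (mul_le_mul_of_nonneg_left hE2 hδ.le))
    ring

theorem Data.Hypotheses.continuousOn_v0 (hD : D.Hypotheses) (i : Fin ne) :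
    ContinuousOn (D.v0 i) (Icc 0 1) := by
  have h0 : 0 < D.γ 0 := hD.γ_pos ⟨le_rfl, hD.T_pos.le⟩
  refine (hD.u0_mem i).cont.comp (by fun_prop) fun y hy => ?_
  have e : D.β 0 = D.α 0 + D.γ 0 := by unfold Data.γ; ring
  rw [e]
  constructor
  · nlinarith [hy.1]
  · nlinarith [hy.2]

theorem IsSchemeSolution.mem_S {k N : ℕ} {P : 𝒯.Nodes k} {Vp : Fin ne → L2}
    {V : ℕ → Fin ne → L2} (h : IsSchemeSolution D 𝒯 P N Vp V) {n : ℕ} (hn : n ≤ N) (i : Fin ne) :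
    V n i ∈ 𝒯.S k := by
  match n with
  | 0 =>
    obtain ⟨W, hW, -, hVW⟩ := h.initial i
    exact ⟨W, hW, hVW⟩
  | 1 => exact h.corrector.1 i
  | n + 2 => exact (h.step (n + 2) (by omega) hn).1 i

/-- The initial values are interpolants of the continuous representative of `v i 0`. -/
theorem norm_initial_error_le {P : 𝒯.Nodes (m + 1)} {N : ℕ} {Vp : Fin ne → L2}
    {V : ℕ → Fin ne → L2} (hD : D.Hypotheses) (hv : D.IsWeakSolution v)
    (hS : ∀ i, D.SpaceRegular (m + 1) M (v i)) (hV : IsSchemeSolution D 𝒯 P N Vp V) (i : Fin ne) :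
    ‖V 0 i - v i 0‖ ≤ M * 𝒯.h ^ (m + 2) := by
  have h0 : (0 : ℝ) ∈ Icc 0 D.T := ⟨le_rfl, hD.T_pos.le⟩
  rw [mul_comm]
  refine (𝒯.norm_interpolant_sub_le P ((hS i).mem 0 h0) (hD.continuousOn_v0 i) (hv.initial i)
    (hV.initial i)).trans ?_
  exact mul_le_mul_of_nonneg_left ((norm_dy_iterate_le _ le_rfl _).trans ((hS i).bound 0 h0))
    (pow_nonneg 𝒯.h_nonneg _)

/-- The first time level: the predictor is only of order `δ ^ (3 / 2)`, but its error enters the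
corrector with another factor `δ ^ (1 / 2)`. -/
theorem norm_sq_first_step_le {P : 𝒯.Nodes (m + 1)} {N : ℕ} {Vp : Fin ne → L2}
    {V : ℕ → Fin ne → L2} (hD : D.Hypotheses) (hK : 0 ≤ K) (hM : 0 ≤ M)
    (htb : D.TimeBounds v K) (hv : D.IsWeakSolution v)
    (hS : ∀ i, D.SpaceRegular (m + 1) M (v i)) (hr : RitzFamily D v 𝒯 (m + 1) r)
    (hV : IsSchemeSolution D 𝒯 P N Vp V) {δ : ℝ} (hδ : 0 < δ) (hδT : δ ≤ D.T)
    (hN : δ = D.T / N) {C₁ : ℝ} (hC₁ : 0 ≤ C₁)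
    (hstep : ∀ {t : ℝ} {Z V V' : Fin ne → L2} {η : ℝ}, 0 ≤ t - δ / 2 → t + δ / 2 ≤ D.T →
      (∀ i, V i ∈ 𝒯.S (m + 1)) → CNStep D (𝒯.S (m + 1)) δ t Z V V' →
      (∀ j, ‖Z j - v j t‖ ≤ η) → ∀ i, ‖V' i - r i (t + δ / 2)‖ ^ 2 ≤
        ‖V i - r i (t - δ / 2)‖ ^ 2 + C₁ * δ * (𝒯.h ^ (m + 2) + δ ^ 2 + η) ^ 2) (i : Fin ne) :
    ‖V 1 i - r i δ‖ ^ 2 ≤ (4 * M ^ 2 + C₁ * (2 * D.T * (1 + M + K) ^ 2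
      + (2 * M ^ 2 * D.T + C₁ * D.T ^ 2 * (1 + M) ^ 2 + C₁ * K ^ 2)))
      * (𝒯.h ^ (m + 2) + δ ^ 2) ^ 2 := by
  have hT := hD.T_pos
  have h0 : (0 : ℝ) ∈ Icc 0 D.T := ⟨le_rfl, hT.le⟩
  have hδm : δ ∈ Icc 0 D.T := ⟨hδ.le, hδT⟩
  have hδ2 : δ / 2 ∈ Icc 0 D.T := ⟨by linarith, by linarith⟩
  have hh : 0 ≤ 𝒯.h ^ (m + 2) := pow_nonneg 𝒯.h_nonneg _
  have hd : 0 ≤ δ ^ 2 := sq_nonneg δ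
  have hpred := hV.predictor
  have hcorr := hV.corrector
  rw [← hN, show (1 / 2 : ℝ) * δ = δ / 2 by ring] at hpred hcorr
  have hV0 : ∀ i, V 0 i ∈ 𝒯.S (m + 1) := fun i => hV.mem_S (Nat.zero_le N) i
  have hinit := norm_initial_error_le hD hv hS hV
  have hρ0 : ∀ i, ‖r i 0 - v i 0‖ ≤ M * 𝒯.h ^ (m + 2) := fun i => hr.norm_sub_le hv hS i h0
  have hρδ : ∀ i, ‖r i δ - v i δ‖ ≤ M * 𝒯.h ^ (m + 2) := fun i => hr.norm_sub_le hv hS i hδm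
  set ε := 𝒯.h ^ (m + 2) + δ ^ 2 with hε
  have hε0 : 0 ≤ ε := by positivity
  have hMε : M * 𝒯.h ^ (m + 2) ≤ M * ε := mul_le_mul_of_nonneg_left (by linarith) hM
  have hKε : K * δ ^ 2 ≤ K * ε := mul_le_mul_of_nonneg_left (by linarith) hK
  have hθ0 : ∀ i, ‖V 0 i - r i 0‖ ^ 2 ≤ 4 * M ^ 2 * ε ^ 2 := by
    intro i
    have h1 : ‖V 0 i - r i 0‖ ≤ 2 * M * ε := by
      have := norm_sub_le (V 0 i - v i 0) (r i 0 - v i 0)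
      rw [sub_sub_sub_cancel_right] at this
      linarith [hinit i, hρ0 i]
    calc ‖V 0 i - r i 0‖ ^ 2 ≤ (2 * M * ε) ^ 2 := pow_le_pow_left₀ (norm_nonneg _) h1 2
      _ = 4 * M ^ 2 * ε ^ 2 := by ring
  -- in the predictor the coefficients are evaluated with an error of first order in `δ`
  have hp : ∀ i, ‖Vp i - r i δ‖ ^ 2 ≤
      4 * M ^ 2 * ε ^ 2 + C₁ * δ * (ε + (M * ε + K * δ)) ^ 2 := by
    intro i
    have h1 := hstep (t := δ / 2) (η := M * ε + K * δ) (by linarith) (by linarith) hV0 hpred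
      (fun j => by
        have h2 := norm_add_le (V 0 j - v j 0) (v j 0 - v j (δ / 2))
        rw [sub_add_sub_cancel] at h2
        have h3 := htb.lipschitz j 0 h0 (δ / 2) hδ2
        rw [zero_sub, abs_neg, abs_of_pos (by positivity)] at h3
        have h4 : K * (δ / 2) ≤ K * δ := mul_le_mul_of_nonneg_left (by linarith) hK
        linarith [hinit j]) i
    rw [add_halves, sub_self] at h1
    linarith [hθ0 i]
  set q := 4 * M ^ 2 * ε ^ 2 + C₁ * δ * (ε + (M * ε + K * δ)) ^ 2 with hq
  have hq0 : 0 ≤ q := by positivity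
  have h1 := hstep (t := δ / 2) (η := √q / 2 + (M + K) * ε) (by linarith) (by linarith) hV0 hcorr
    (fun j => by
      have e : (1 / 2 : ℝ) • (Vp j + V 0 j) - v j (δ / 2)
          = (1 / 2 : ℝ) • ((Vp j - r j δ) + (r j δ - v j δ) + (V 0 j - v j 0))
            + ((1 / 2 : ℝ) • (v j δ + v j 0) - v j (δ / 2)) := by module
      have h2 := htb.average j (δ / 2) δ hδ (by linarith) (by linarith)
      rw [add_halves, sub_self] at h2
      have h3 : ‖Vp j - r j δ‖ ≤ √q := Real.le_sqrt_of_sq_le (hp j)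
      rw [e]
      refine (norm_add_le _ _).trans ?_
      rw [norm_smul, Real.norm_of_nonneg (by norm_num)]
      have h4 := norm_add₃_le (a := Vp j - r j δ) (b := r j δ - v j δ) (c := V 0 j - v j 0)
      linarith [hinit j, hρδ j]) i
  rw [add_halves, sub_self] at h1
  have hεη : δ * (ε + (√q / 2 + (M + K) * ε)) ^ 2
      ≤ 2 * D.T * (1 + M + K) ^ 2 * ε ^ 2 + δ * q / 2 := by
    have h2 : (ε + (√q / 2 + (M + K) * ε)) ^ 2 ≤ 2 * ((1 + M + K) * ε) ^ 2 + q / 2 := by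
      nlinarith [sq_nonneg ((1 + M + K) * ε - √q / 2), Real.sq_sqrt hq0]
    calc δ * (ε + (√q / 2 + (M + K) * ε)) ^ 2
        ≤ δ * (2 * ((1 + M + K) * ε) ^ 2 + q / 2) := mul_le_mul_of_nonneg_left h2 hδ.le
      _ = δ * (2 * ((1 + M + K) * ε) ^ 2) + δ * q / 2 := by ring
      _ ≤ D.T * (2 * ((1 + M + K) * ε) ^ 2) + δ * q / 2 := by gcongr
      _ = _ := by ring
  -- the extra factor `δ` restores the optimal order: `δ * (δ * δ ^ 2)` is bounded by `ε ^ 2`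
  have hδq : δ * q ≤ 2 * (2 * M ^ 2 * D.T + C₁ * D.T ^ 2 * (1 + M) ^ 2 + C₁ * K ^ 2) * ε ^ 2 := by
    have h2 : (ε + (M * ε + K * δ)) ^ 2 ≤ 2 * ((1 + M) ^ 2 * ε ^ 2) + 2 * (K ^ 2 * δ ^ 2) := by
      nlinarith [sq_nonneg ((1 + M) * ε - K * δ)]
    have h3 : δ ^ 2 ≤ D.T ^ 2 := pow_le_pow_left₀ hδ.le hδT 2
    have h4 : δ ^ 2 * δ ^ 2 ≤ ε ^ 2 := by
      rw [← sq]
      exact pow_le_pow_left₀ hd (by linarith) 2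
    calc δ * q = δ * (4 * M ^ 2 * ε ^ 2) + C₁ * (δ ^ 2 * (ε + (M * ε + K * δ)) ^ 2) := by
          rw [hq]; ring
      _ ≤ D.T * (4 * M ^ 2 * ε ^ 2)
          + C₁ * (δ ^ 2 * (2 * ((1 + M) ^ 2 * ε ^ 2) + 2 * (K ^ 2 * δ ^ 2))) := by gcongr
      _ = D.T * (4 * M ^ 2 * ε ^ 2)
          + C₁ * (2 * (1 + M) ^ 2 * ε ^ 2 * δ ^ 2 + 2 * K ^ 2 * (δ ^ 2 * δ ^ 2)) := by ring
      _ ≤ D.T * (4 * M ^ 2 * ε ^ 2)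
          + C₁ * (2 * (1 + M) ^ 2 * ε ^ 2 * D.T ^ 2 + 2 * K ^ 2 * ε ^ 2) := by gcongr
      _ = _ := by ring
  calc ‖V 1 i - r i δ‖ ^ 2
      ≤ 4 * M ^ 2 * ε ^ 2 + C₁ * (δ * (ε + (√q / 2 + (M + K) * ε)) ^ 2) := by linarith [hθ0 i]
    _ ≤ 4 * M ^ 2 * ε ^ 2 + C₁ * (2 * D.T * (1 + M + K) ^ 2 * ε ^ 2
        + (2 * M ^ 2 * D.T + C₁ * D.T ^ 2 * (1 + M) ^ 2 + C₁ * K ^ 2) * ε ^ 2) := by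
        gcongr
        linarith
    _ = _ := by ring

/-- The extrapolated argument `3/2 V₁ - 1/2 V₀` of the coefficients, split into the distances to the
Ritz projections, the errors of the latter, and the extrapolation error of the exact solution. -/
theorem norm_extrapolation_error_le {E : Type*} [NormedAddCommGroup E] [NormedSpace ℝ E]
    {V₁ V₀ r₁ r₀ v₁ v₀ w : E} {x y z : ℝ} (h₁ : ‖V₁ - r₁‖ ≤ x) (h₀ : ‖V₀ - r₀‖ ≤ x)
    (hr₁ : ‖r₁ - v₁‖ ≤ y) (hr₀ : ‖r₀ - v₀‖ ≤ y)
    (hv : ‖(3 / 2 : ℝ) • v₁ - (1 / 2 : ℝ) • v₀ - w‖ ≤ z) :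
    ‖(3 / 2 : ℝ) • V₁ - (1 / 2 : ℝ) • V₀ - w‖ ≤ 2 * (x + y) + z := by
  have e : (3 / 2 : ℝ) • V₁ - (1 / 2 : ℝ) • V₀ - w
      = (3 / 2 : ℝ) • ((V₁ - r₁) + (r₁ - v₁)) - (1 / 2 : ℝ) • ((V₀ - r₀) + (r₀ - v₀))
        + ((3 / 2 : ℝ) • v₁ - (1 / 2 : ℝ) • v₀ - w) := by
    module
  rw [e]
  refine (norm_add_le _ _).trans ((add_le_add (norm_sub_le _ _) hv).trans ?_)
  rw [norm_smul, norm_smul, Real.norm_of_nonneg (by norm_num), Real.norm_of_nonneg (by norm_num)]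
  linarith [norm_add_le (V₁ - r₁) (r₁ - v₁), norm_add_le (V₀ - r₀) (r₀ - v₀)]

/-- The discrete Gronwall argument: from a bound on the first two time levels, the distance of the
discrete solution from the Ritz projection grows at most exponentially in time. -/
theorem norm_sub_ritz_le {P : 𝒯.Nodes (m + 1)} {N : ℕ} {Vp : Fin ne → L2}
    {V : ℕ → Fin ne → L2} (hK : 0 ≤ K) (hM : 0 ≤ M) (htb : D.TimeBounds v K)
    (hV : IsSchemeSolution D 𝒯 P N Vp V) {δ : ℝ} (hδ : 0 < δ) (hδN : δ = D.T / N)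
    (hnT : ∀ n : ℕ, n ≤ N → (n : ℝ) * δ ≤ D.T) {C₁ : ℝ} (hC₁ : 0 ≤ C₁)
    (hstep : ∀ {t : ℝ} {Z V V' : Fin ne → L2} {η : ℝ}, 0 ≤ t - δ / 2 → t + δ / 2 ≤ D.T →
      (∀ i, V i ∈ 𝒯.S (m + 1)) → CNStep D (𝒯.S (m + 1)) δ t Z V V' →
      (∀ j, ‖Z j - v j t‖ ≤ η) → ∀ i, ‖V' i - r i (t + δ / 2)‖ ^ 2 ≤
        ‖V i - r i (t - δ / 2)‖ ^ 2 + C₁ * δ * (𝒯.h ^ (m + 2) + δ ^ 2 + η) ^ 2)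
    (hρ : ∀ i (n : ℕ), n ≤ N → ‖r i (n * δ) - v i (n * δ)‖ ≤ M * 𝒯.h ^ (m + 2))
    {a : ℝ} (ha : 1 ≤ a) (h₀ : ∀ i, ‖V 0 i - r i 0‖ ≤ a * (𝒯.h ^ (m + 2) + δ ^ 2))
    (h₁ : ∀ i, ‖V 1 i - r i δ‖ ≤ a * (𝒯.h ^ (m + 2) + δ ^ 2)) (n : ℕ) :
    n ≤ N → ∀ i, ‖V n i - r i (n * δ)‖
      ≤ a * Real.exp (C₁ * (3 + 2 * M + K) ^ 2 * (n * δ)) * (𝒯.h ^ (m + 2) + δ ^ 2) := by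
  have hh : 0 ≤ 𝒯.h ^ (m + 2) := pow_nonneg 𝒯.h_nonneg _
  have hn0 : ∀ n : ℕ, 0 ≤ (n : ℝ) * δ := fun n => by positivity
  obtain ⟨B, hBd⟩ : ∃ B, B = C₁ * (3 + 2 * M + K) ^ 2 := ⟨_, rfl⟩
  have hB : 0 ≤ B := by rw [hBd]; positivity
  rw [← hBd]
  have hKε : K * δ ^ 2 ≤ K * (𝒯.h ^ (m + 2) + δ ^ 2) := mul_le_mul_of_nonneg_left (by linarith) hK
  have hMε : M * 𝒯.h ^ (m + 2) ≤ M * (𝒯.h ^ (m + 2) + δ ^ 2) :=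
    mul_le_mul_of_nonneg_left (by linarith [sq_nonneg δ]) hM
  have hε0 : 0 ≤ 𝒯.h ^ (m + 2) + δ ^ 2 := by positivity
  generalize 𝒯.h ^ (m + 2) + δ ^ 2 = ε at hKε hMε hε0 h₀ h₁ hstep ⊢
  have hexp : ∀ x : ℝ, 0 ≤ x → a ≤ a * Real.exp (B * x) := fun x hx =>
    le_mul_of_one_le_right (by linarith) (Real.one_le_exp (mul_nonneg hB hx))
  induction n using Nat.strong_induction_on with
  | _ n ih =>
    intro hn i
    match n with
    | 0 =>
      rw [Nat.cast_zero, zero_mul]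
      exact (h₀ i).trans (mul_le_mul_of_nonneg_right (hexp 0 le_rfl) hε0)
    | 1 =>
      rw [Nat.cast_one, one_mul]
      exact (h₁ i).trans (mul_le_mul_of_nonneg_right (hexp δ hδ.le) hε0)
    | n + 2 =>
      -- `q * ε` bounds the errors at both of the preceding levels
      obtain ⟨q, hq⟩ : ∃ q, q = a * Real.exp (B * ((n + 1 : ℕ) * δ)) := ⟨_, rfl⟩
      have hq1 : 1 ≤ q := hq ▸ ha.trans (hexp _ (hn0 _))
      have ih1 := ih (n + 1) (by omega) (by omega)
      rw [← hq] at ih1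
      have ih0 : ∀ j, ‖V n j - r j (n * δ)‖ ≤ q * ε := fun j => by
        refine (ih n (by omega) (by omega) j).trans (mul_le_mul_of_nonneg_right ?_ hε0)
        rw [hq]
        gcongr
        omega
      have hCN := hV.step (n + 2) (by omega) hn
      rw [← hδN, show n + 2 - 1 = n + 1 by omega, show n + 2 - 2 = n by omega] at hCN
      have hnT2 := hnT (n + 2) hn
      have hn0' := hn0 n
      have e4 : a * Real.exp (B * ((n + 2 : ℕ) * δ)) * ε = q * ε * Real.exp (B * δ) := by
        have : B * ((n + 2 : ℕ) * δ) = B * ((n + 1 : ℕ) * δ) + B * δ := by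
          push_cast
          ring
        rw [this, Real.exp_add, hq]
        ring
      rw [e4]
      clear e4 hq
      have hρ1 := fun j => hρ j (n + 1) (by omega)
      push_cast at hCN hnT2 ih1 hρ1 ⊢
      obtain ⟨t, ht⟩ : ∃ t, t = ((n : ℝ) + 2 - 1 / 2) * δ := ⟨_, rfl⟩
      rw [← ht] at hCN
      have e1 : t - δ / 2 = (n + 1) * δ := by rw [ht]; ring
      have e2 : t + δ / 2 = (n + 2) * δ := by rw [ht]; ring
      have e3 : t - 3 * (δ / 2) = n * δ := by rw [ht]; ring
      have hext := fun j => htb.extrapolation j t δ hδ (by linarith) (by linarith)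
      rw [e1, e3] at hext
      have h1 := hstep (η := 2 * (q * ε + M * ε) + K * ε) (by rw [e1]; positivity)
        (by rw [e2]; exact hnT2) (fun j => hV.mem_S (by omega) j) hCN (fun j =>
          norm_extrapolation_error_le (ih1 j) (ih0 j) ((hρ1 j).trans hMε)
            ((hρ j n (by omega)).trans hMε) ((hext j).trans hKε)) i
      rw [e1, e2] at h1
      have h2 : ε + (2 * (q * ε + M * ε) + K * ε) ≤ q * (3 + 2 * M + K) * ε := by
        have : 1 + (2 * q + 2 * M + K) ≤ q * (3 + 2 * M + K) := by nlinarith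
        nlinarith
      have h3 : ‖V (n + 2) i - r i ((n + 2) * δ)‖ ^ 2 ≤ (q * ε) ^ 2 * (1 + B * δ) := by
        calc _ ≤ (q * ε) ^ 2 + C₁ * δ * (q * (3 + 2 * M + K) * ε) ^ 2 := by
              refine h1.trans (add_le_add (pow_le_pow_left₀ (norm_nonneg _) (ih1 i) 2) ?_)
              gcongr
          _ = (q * ε) ^ 2 * (1 + B * δ) := by rw [hBd]; ring
      have h5 : 1 + B * δ ≤ Real.exp (B * δ) ^ 2 := by
        have h6 := Real.add_one_le_exp (B * δ)
        have h7 : 0 ≤ B * δ := by positivity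
        nlinarith
      refine le_of_sq_le_sq (h3.trans ?_) (by positivity)
      rw [mul_pow _ (Real.exp (B * δ))]
      exact mul_le_mul_of_nonneg_left h5 (sq_nonneg _)

end CNGalerkin

end


theorem mainTheorem2 (ne : ℕ) (D : CNGalerkin.Data ne) (hD : D.Hypotheses)
    (v : Fin ne → ℝ → CNGalerkin.L2) (hv : D.IsWeakSolution v)
    (hreg : ∀ i, D.TimeRegular (v i)) (M : ℝ) :
    ∃ C : ℝ, 0 < C ∧
      ∀ k : ℕ, 1 ≤ k → (∀ i, D.SpaceRegular k M (v i)) →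
      ∀ (𝒯 : CNGalerkin.Mesh) (P : 𝒯.Nodes k) (N : ℕ), 1 ≤ N →
      ∀ (Vp : Fin ne → CNGalerkin.L2) (V : ℕ → Fin ne → CNGalerkin.L2),
        CNGalerkin.IsSchemeSolution D 𝒯 P N Vp V →
        ∀ n : ℕ, 1 ≤ n → n ≤ N → ∀ i,
          ‖V n i - v i (n * (D.T / N))‖ ≤ C * (𝒯.h ^ (k + 1) + (D.T / N) ^ 2) := by
  have hT := hD.T_pos
  obtain ⟨c, hc, hbe⟩ := hD.exists_coeffBounds
  obtain ⟨K, hb, htb, hK⟩ := (hbe.and ((hD.eventually_timeBounds hreg).and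
    (eventually_ge_atTop 0))).exists
  -- `M` may be negative if there are no equations at all
  obtain ⟨M', hM, hMM'⟩ : ∃ M', 0 ≤ M' ∧ M ≤ M' := ⟨|M|, abs_nonneg M, le_abs_self M⟩
  obtain ⟨C₁, hC₁d⟩ : ∃ C₁, C₁ = ((2 + 5 * K) * (K + K ^ 2 + M')) ^ 2 / (2 * c) := ⟨_, rfl⟩
  have hC₁ : 0 ≤ C₁ := by rw [hC₁d]; positivity
  obtain ⟨A, hAd⟩ : ∃ A, A = 4 * M' ^ 2 + C₁ * (2 * D.T * (1 + M' + K) ^ 2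
      + (2 * M' ^ 2 * D.T + C₁ * D.T ^ 2 * (1 + M') ^ 2 + C₁ * K ^ 2)) := ⟨_, rfl⟩
  have hA : 0 ≤ A := by rw [hAd]; positivity
  obtain ⟨B, hBd⟩ : ∃ B, B = C₁ * (3 + 2 * M' + K) ^ 2 := ⟨_, rfl⟩
  have hB : 0 ≤ B := by rw [hBd]; positivity
  obtain ⟨a, had⟩ : ∃ a, a = 1 + 2 * M' + A := ⟨_, rfl⟩
  have ha : 1 ≤ a := by linarith
  refine ⟨a * Real.exp (B * D.T) + M', by positivity, ?_⟩
  intro k hk hS 𝒯 P N hN Vp V hV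
  obtain ⟨m, rfl⟩ : ∃ m, k = m + 1 := ⟨k - 1, by omega⟩
  replace hS : ∀ i, D.SpaceRegular (m + 1) M' (v i) := fun i => (hS i).mono hMM'
  have hr : ∀ i t, ∃ r, t ∈ Icc 0 D.T → 𝒯.IsRitz (m + 1) (v i t) r := by
    intro i t
    by_cases ht : t ∈ Icc 0 D.T
    · obtain ⟨r, hr⟩ := CNGalerkin.Mesh.exists_isRitz (𝒯 := 𝒯) m (hv.mem_H01 i t ht)
      exact ⟨r, fun _ => hr⟩
    · exact ⟨0, fun h => absurd h ht⟩
  choose r hr using hr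
  replace hr : CNGalerkin.RitzFamily D v 𝒯 (m + 1) r := hr
  have hN0 : (0 : ℝ) < N := by exact_mod_cast hN
  obtain ⟨δ, hδN⟩ : ∃ δ, δ = D.T / N := ⟨_, rfl⟩
  have hδ : 0 < δ := hδN ▸ div_pos hT hN0
  have hNδ : N * δ = D.T := by rw [hδN]; field_simp
  have hnT : ∀ n : ℕ, n ≤ N → (n : ℝ) * δ ≤ D.T := fun n hn => by
    rw [← hNδ]
    exact mul_le_mul_of_nonneg_right (by exact_mod_cast hn) hδ.le
  have hn0 : ∀ n : ℕ, 0 ≤ (n : ℝ) * δ := fun n => by positivity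
  have hδT : δ ≤ D.T := by simpa using hnT 1 hN
  have hstep : ∀ {t : ℝ} {Z V V' : Fin ne → CNGalerkin.L2} {η : ℝ}, 0 ≤ t - δ / 2 →
      t + δ / 2 ≤ D.T → (∀ i, V i ∈ 𝒯.S (m + 1)) → CNGalerkin.CNStep D (𝒯.S (m + 1)) δ t Z V V' →
      (∀ j, ‖Z j - v j t‖ ≤ η) → ∀ i, ‖V' i - r i (t + δ / 2)‖ ^ 2 ≤
        ‖V i - r i (t - δ / 2)‖ ^ 2 + C₁ * δ * (𝒯.h ^ (m + 2) + δ ^ 2 + η) ^ 2 := by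
    intro t Z V V' η h0 h1 hVS hCN hη i
    refine (hCN.norm_sq_le hc hb htb hK hM hv hS hr hδ h0 h1 hVS hη i).trans (le_of_eq ?_)
    rw [hC₁d]
    ring
  have hfirst := CNGalerkin.norm_sq_first_step_le hD hK hM htb hv hS hr hV hδ hδT hδN hC₁ hstep
  rw [← hAd] at hfirst
  have hinit := CNGalerkin.norm_initial_error_le hD hv hS hV
  have hρ : ∀ i (n : ℕ), n ≤ N → ‖r i (n * δ) - v i (n * δ)‖ ≤ M' * 𝒯.h ^ (m + 2) :=
    fun i n hn => hr.norm_sub_le hv hS i ⟨hn0 n, hnT n hn⟩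
  have hh : 0 ≤ 𝒯.h ^ (m + 2) := pow_nonneg 𝒯.h_nonneg _
  rw [← hδN]
  set ε := 𝒯.h ^ (m + 2) + δ ^ 2 with hε
  have hε0 : 0 ≤ ε := by positivity
  have hMε : M' * 𝒯.h ^ (m + 2) ≤ M' * ε :=
    mul_le_mul_of_nonneg_left (by linarith [sq_nonneg δ]) hM
  have h₀ : ∀ i, ‖V 0 i - r i 0‖ ≤ a * ε := by
    intro i
    have h1 := norm_sub_le (V 0 i - v i 0) (r i 0 - v i 0)
    rw [sub_sub_sub_cancel_right] at h1
    have h2 := hρ i 0 (Nat.zero_le N)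
    rw [Nat.cast_zero, zero_mul] at h2
    have h3 : 2 * M' * ε ≤ a * ε := mul_le_mul_of_nonneg_right (by linarith) hε0
    linarith [hinit i]
  have h₁ : ∀ i, ‖V 1 i - r i δ‖ ≤ a * ε := by
    intro i
    refine le_of_sq_le_sq ((hfirst i).trans ?_) (by positivity)
    rw [mul_pow]
    exact mul_le_mul_of_nonneg_right (by nlinarith) (sq_nonneg ε)
  have key := CNGalerkin.norm_sub_ritz_le hK hM htb hV hδ hδN hnT hC₁ hstep hρ ha h₀ h₁
  rw [← hBd] at key
  intro n _ hn i
  have h1 := norm_add_le (V n i - r i (n * δ)) (r i (n * δ) - v i (n * δ))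
  rw [sub_add_sub_cancel] at h1
  have h2 : a * Real.exp (B * (n * δ)) * ε ≤ a * Real.exp (B * D.T) * ε := by
    have := hnT n hn
    gcongr
  have h3 : (a * Real.exp (B * D.T) + M') * ε = a * Real.exp (B * D.T) * ε + M' * ε := by ring
  rw [h3]
  linarith [key n hn i, hρ i n hn]
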